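/- Let $n\ge 2$, let $\mathbb{F}$ be one of $\mathbb{R},\mathbb{C},\mathbb{H}$, let $m=\dim_{\mathbb{R}}\mathbb{F}\in\{1,2,4\}$, and put $p=\left\lfloor\frac{n-1}{2}\right\rfloor$. Let $E(n,\mathbb{F})=\{A\in M(n,\mathbb{F}): A^*=A,\ \operatorname{tr}A=0\}$ be the real vector space of traceless Hermitian $n\times n$ matrices over $\mathbb{F}$, of dimension $N(n,\mathbb{F})=\frac12 n(n-1)m+n-1$, and let $S(n,\mathbb{F})$ be its unit sphere with respect to the Frobenius norm. Define $$\Phi_{n,\mathbb{F}}:S(n,\mathbb{F})\to\mathbb{R}^p,\qquad A\mapsto(\operatorname{tr}A^3,\operatorname{tr}A^5,\dots,\operatorname{tr}A^{2p+1}),$$ and let $\mathcal{B}_{n,\mathbb{F}}$ be the set of all $A\in\Phi_{n,\mathbb{F}}^{-1}(0)$ that are regular points of $\Phi_{n,\mathbb{F}}$, i.e. at which the differential of $\Phi_{n,\mathbb{F}}$ is surjective. Then $\mathcal{B}_{n,\mathbb{F}}$ is a smooth embedded submanifold of $S(n,\mathbb{F})$ of dimension $N(n,\mathbb{F})-p-1$,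 and it is 1. orientable; 2. connected (and nonempty); 3. full, i.e. not contained in any proper great subsphere of $S(n,\mathbb{F})$; 4. austere in $S(n,\mathbb{F})$, i.e. for every normal vector $\xi$, the nonzero principal curvatures in direction $\xi$ occur in oppositely signed pairs: $c$ and $-c$ have the same multiplicity as eigenvalues of the shape operator $A_\xi$, for every real $c$; 5. of flat normal bundle in $S(n,\mathbb{F})$, i.e. its normal connection is flat: every normal vector extends locally to a parallel normal field. -/

import Mathlib

open scoped Matrix.Norms.Frobenius Quaternion ContDiff

noncomputable section

/-! ### Submanifolds of a submanifold of a Euclidean space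

Throughout, `V` is a finite-dimensional real inner product space, and submanifolds are embedded
submanifolds of `V`, with the induced metric. -/

namespace EuclideanSubmanifold

variable {V : Type*} [NormedAddCommGroup V] [InnerProductSpace ℝ V] [FiniteDimensional ℝ V]

/-- `M` is a smooth embedded submanifold of `V` of dimension `d`: around each of its points some
smooth diffeomorphism between open subsets of `V` carries `M` to a `d`-dimensional linear
subspace. -/
def IsSubmanifold (M : Set V) (d : ℕ) : Prop :=
  ∀ x ∈ M, ∃ (W : Submodule ℝ V) (φ : OpenPartialHomeomorph V V),
    Module.finrank ℝ W = d ∧ x ∈ φ.source ∧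
    ContDiffOn ℝ ∞ φ φ.source ∧ ContDiffOn ℝ ∞ φ.symm φ.target ∧
    ∀ y ∈ φ.source, y ∈ M ↔ φ y ∈ W

/-- The tangent space of `M` at `x`, spanned by the velocities at `x` of smooth curves in `M`. (For
a submanifold these velocities already form a linear subspace.) -/
def tangentSpace (M : Set V) (x : V) : Submodule ℝ V :=
  Submodule.span ℝ {v | ∃ γ : ℝ → V, ContDiffAt ℝ ∞ γ 0 ∧ γ 0 = x ∧
    (∀ᶠ t in nhds (0 : ℝ), γ t ∈ M) ∧ deriv γ 0 = v}

/-- The normal space at `x` of `M`, regarded as a submanifold of the submanifold `N`: the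
orthogonal complement of `T_x M` in `T_x N`. -/
def normalSpace (N M : Set V) (x : V) : Submodule ℝ V :=
  tangentSpace N x ⊓ (tangentSpace M x)ᗮ

/-- The differential at `x` of the map `Φ` restricted to the submanifold `M`. (On `T_x M` the
derivative within `M` does not depend on choices.) -/
def differential {G : Type*} [NormedAddCommGroup G] [NormedSpace ℝ G]
    (M : Set V) (Φ : V → G) (x : V) : tangentSpace M x →L[ℝ] G :=
  (fderivWithin ℝ Φ M x).comp (tangentSpace M x).subtypeL

/-- `x` is a regular point of the restriction of `Φ` to the submanifold `M`. -/
def IsRegularPoint {G : Type*} [NormedAddCommGroup G] [NormedSpace ℝ G]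
    (M : Set V) (Φ : V → G) (x : V) : Prop :=
  Function.Surjective (differential M Φ x)

/-- `M` is orientable: it carries a smooth differential form of top degree `d` without zeros. (Every
smooth form on `M` arises from a smooth map on `M` to the alternating forms on `V`.) -/
def IsOrientable (M : Set V) (d : ℕ) : Prop :=
  ∃ η : V → V [⋀^Fin d]→L[ℝ] ℝ, ContDiffOn ℝ ∞ η M ∧
    ∀ x ∈ M, ∃ v : Fin d → V, (∀ i, v i ∈ tangentSpace M x) ∧ η x v ≠ 0

/-- `ξ` is a smooth normal vector field along `M ∩ U`, for `M` as a submanifold of `N`. -/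
structure IsNormalField (N M U : Set V) (ξ : V → V) : Prop where
  smooth : ContDiffOn ℝ ∞ ξ (M ∩ U)
  normal : ∀ y ∈ M ∩ U, ξ y ∈ normalSpace N M y

/-- The shape operator `X ↦ -(∇_X ξ)ᵀ` of `M` at `x` in direction of the normal field `ξ`. Here `∇`
is the Levi-Civita connection of the ambient submanifold `N ⊇ M`, that is the projection to `T N` of
the directional derivative in `V`; as `T M ⊆ T N`, its component tangent to `M` is the
projection to `T M` of the directional derivative. -/
def shapeOperator (M : Set V) (ξ : V → V) (x : V) :
    tangentSpace M x →L[ℝ] tangentSpace M x :=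
  -((tangentSpace M x).orthogonalProjectionOnto.comp (differential M ξ x))

/-- `M ⊆ N` is austere: in every normal direction, opposite numbers are principal curvatures of the
same multiplicity. The principal curvatures in direction of the normal vector `ξ x` are the
eigenvalues of the (self-adjoint) shape operator. -/
def IsAustere (N M : Set V) : Prop :=
  ∀ (U : Set V) (ξ : V → V), IsOpen U → IsNormalField N M U ξ → ∀ x ∈ M ∩ U, ∀ c : ℝ,
    Module.finrank ℝ (Module.End.eigenspace
        (shapeOperator M ξ x : Module.End ℝ (tangentSpace M x)) c) =
      Module.finrank ℝ (Module.End.eigenspace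
        (shapeOperator M ξ x : Module.End ℝ (tangentSpace M x)) (-c))

/-- The covariant derivative at `x` of the normal field `ξ` for the normal connection of `M ⊆ N`, as
a map `X ↦ ∇^⊥_X ξ` from tangent to normal vectors. -/
def normalDerivative (N M : Set V) (ξ : V → V) (x : V) :
    tangentSpace M x →L[ℝ] normalSpace N M x :=
  (normalSpace N M x).orthogonalProjectionOnto.comp (differential M ξ x)

/-- The normal bundle of `M ⊆ N` is flat: every normal vector extends locally to a parallel normal
field, equivalently, there are local parallel frames. -/
def HasFlatNormalBundle (N M : Set V) : Prop :=
  ∀ x ∈ M, ∀ v ∈ normalSpace N M x, ∃ (U : Set V) (ξ : V → V), IsOpen U ∧ x ∈ U ∧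
    IsNormalField N M U ξ ∧ ξ x = v ∧ ∀ y ∈ M ∩ U, normalDerivative N M ξ y = 0

/-- The subset `M` of the unit sphere of `V` is full: it lies in no proper great subsphere. -/
def IsFull (M : Set V) : Prop :=
  ∀ W : Submodule ℝ V, M ⊆ W → W = ⊤

end EuclideanSubmanifold

/-! ### Hermitian matrices over `ℝ`, `ℂ`, `ℍ`

The definitions are written for a real normed algebra `F` with a conjugation and a real inner
product, and are used for `ℝ`, `ℂ`, `ℍ` with `⟪a, b⟫ = Re (a * star b)`. Matrices carry the
Frobenius norm. -/

namespace HermitianSphere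

open EuclideanSubmanifold

/-- The real inner product `Re tr (A Bᴴ)` that induces the Frobenius norm. -/
instance frobeniusInnerProductSpace (n : ℕ) (F : Type*) [NormedAddCommGroup F]
    [InnerProductSpace ℝ F] : InnerProductSpace ℝ (Matrix (Fin n) (Fin n) F) where
  toNormedSpace := Matrix.frobeniusNormedSpace
  inner A B := ∑ i, ∑ j, inner ℝ (A i j) (B i j)
  norm_sq_eq_re_inner A := by
    have h : 0 ≤ ∑ i, ∑ j, ‖A i j‖ ^ (2 : ℝ) := by positivity
    rw [Matrix.frobenius_norm_def, ← Real.sqrt_eq_rpow, Real.sq_sqrt h]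
    simp
  conj_inner_symm A B := by simp [real_inner_comm]
  add_left A B C := by simp [inner_add_left, Finset.sum_add_distrib]
  smul_left A B r := by simp [real_inner_smul_left, Finset.mul_sum]

instance quaternionStarModule : StarModule ℝ ℍ[ℝ] := ⟨fun r a => by simp⟩

variable (n : ℕ) (F : Type*) [NormedRing F] [StarRing F] [InnerProductSpace ℝ F] [StarModule ℝ F]

/-- `E(n, F)`: the real vector space of traceless Hermitian matrices. -/
def E : Submodule ℝ (Matrix (Fin n) (Fin n) F) where
  carrier := {A | A.IsHermitian ∧ A.trace = 0}
  add_mem' := by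
    rintro A B ⟨hA, hA'⟩ ⟨hB, hB'⟩
    exact ⟨hA.add hB, by simp [hA', hB']⟩
  zero_mem' := ⟨Matrix.isHermitian_zero, by simp⟩
  smul_mem' := by
    rintro r A ⟨hA, hA'⟩
    exact ⟨by simp [Matrix.IsHermitian, Matrix.conjTranspose_smul, hA.eq],
      by simp [hA']⟩

/-- `N(n, F) = n(n-1)m/2 + n - 1` with `m = dim_ℝ F`. -/
def N : ℕ := n * (n - 1) / 2 * Module.finrank ℝ F + n - 1

/-- `S(n, F)`: the unit sphere in `E(n, F)` for the Frobenius norm. -/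
def S : Set (E n F) := Metric.sphere 0 1

variable {n F}

/-- `f_k(A) = tr A^k`, which is real for Hermitian `A`; as a real number it is its real part. -/
def f (k : ℕ) (A : E n F) : ℝ := inner ℝ (1 : F) (Matrix.trace ((A : Matrix (Fin n) (Fin n) F) ^ k))

/-- `Φ = (f_3, f_5, …, f_{2p+1})` with `p = ⌊(n-1)/2⌋`, as a map on `E(n, F)`. -/
def Phi (A : E n F) : Fin ((n - 1) / 2) → ℝ := fun i => f (2 * (i : ℕ) + 3) A

variable (n F)

/-- `B_{n,F}`: the regular points of `Φ : S(n, F) → ℝ^p` in its zero level set. -/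
def B [FiniteDimensional ℝ F] : Set (E n F) :=
  {A | A ∈ S n F ∧ Phi A = 0 ∧ IsRegularPoint (S n F) Phi A}

end HermitianSphere

end

/-! The gradient of `f k` on `E n F` is `k` times the traceless part of `A ^ (k - 1)`. On the zero
set of `Phi` the gradients of its components are tangent to the sphere, because `⟪A ^ (2j+2), A⟫ =
Re tr A ^ (2j+3) = 0`. So `A` is a regular point exactly when `1, A ^ 2, …, A ^ (2p)` are linearly
independent, and the traceless parts of `A ^ 2, …, A ^ (2p)` form a global frame of the normal
bundle in the sphere. Together with `A` they give a normal frame in `E n F`, whence the submanifold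
property and orientability (`HomogeneousSystem`).

Everything else is read off the spectrum (`mem_B_iff`). If the trace and the odd power sums up to
`n` vanish, Newton's identities show that the decreasing spectrum `a` satisfies `a i.rev = -a i`. By
Vandermonde, independence of the even powers means that the `p + 1` squares in the first half of the
spectrum are distinct. Thus `B` consists of the `Uᴴ diag(a) U` with `U` unitary and `a` a unit
vector of the convex cone `spectralCone`. By `exists_diagonalization`, `U` may be taken in the
identity component of the unitary group, even over `ℝ`.

Connectedness: `B` is a continuous image of that component times the cone. Fullness: a matrix `X`
orthogonal to `B` is tested against an element of `B` diagonalized together with `X`; a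
rearrangement argument gives `X = 0`.

Austerity: if `R` exchanges the eigenvectors of `x` belonging to `a i` and `-a i`, then `Y ↦ -R Y R`
is an isometric involution that preserves `B`, fixes `x` and reverses every normal vector at `x`. It
therefore conjugates each shape operator at `x` to its negative.

Flatness: the spectral projections `Q` of `A ^ 2` depend smoothly on `A`, as their number is
constant on `B`. Differentiating `Q * Q = Q` shows that `Q'` is orthogonal to all matrices commuting
with `Q`, in particular to the even powers of `A`. So combinations of the `Q` with constant
coefficients project to parallel normal fields, and by Lagrange interpolation every normal vector is
the value of such a field. -/

set_option linter.unusedSectionVars false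

noncomputable section

/-! ### Regular level sets: charts, tangent spaces, orientability. -/

namespace EuclideanSubmanifold

open Filter Topology

/-- The inverse function theorem, with an explicit smooth inverse on an open set on which the
derivative stays invertible. -/
theorem exists_smooth_local_inverse {W W' : Type*} [NormedAddCommGroup W] [NormedSpace ℝ W]
    [CompleteSpace W] [NormedAddCommGroup W'] [NormedSpace ℝ W'] {Φ : W → W'}
    (hΦ : ContDiff ℝ ∞ Φ) {x : W} (L : W ≃L[ℝ] W') (hL : HasFDerivAt Φ (L : W →L[ℝ] W') x)
    {O : Set W} (hO : IsOpen O) (hx : x ∈ O) :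
    ∃ e : OpenPartialHomeomorph W W', (e : W → W') = Φ ∧ x ∈ e.source ∧ e.source ⊆ O ∧
      ContDiffOn ℝ ∞ e.symm e.target ∧
      ∀ y ∈ e.source, ∃ L' : W ≃L[ℝ] W', HasFDerivAt Φ (L' : W →L[ℝ] W') y := by
  -- Invertibility of the derivative is an open condition; restricting to it makes the inverse
  -- smooth on the whole target and not only near the image of `x`.
  have hO' : IsOpen (O ∩ fderiv ℝ Φ ⁻¹' Set.range ((↑) : (W ≃L[ℝ] W') → W →L[ℝ] W')) :=
    hO.inter (ContinuousLinearEquiv.isOpen.preimage (hΦ.continuous_fderiv (by simp)))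
  let e₀ := hΦ.contDiffAt.toOpenPartialHomeomorph Φ hL (by simp)
  have he₀ : (e₀ : W → W') = Φ := hΦ.contDiffAt.toOpenPartialHomeomorph_coe hL (by simp)
  have hx₀ : x ∈ e₀.source := hΦ.contDiffAt.mem_toOpenPartialHomeomorph_source hL (by simp)
  let e := e₀.restrOpen _ hO'
  have he : (e : W → W') = Φ := he₀
  have hsrc : e.source = e₀.source ∩ (O ∩ fderiv ℝ Φ ⁻¹' Set.range _) := rfl
  have hder : ∀ y ∈ e.source, ∃ L' : W ≃L[ℝ] W', HasFDerivAt Φ (L' : W →L[ℝ] W') y := by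
    intro y hy
    obtain ⟨L', hL'⟩ := (hsrc ▸ hy).2.2
    exact ⟨L', hL' ▸ (hΦ.differentiable (by simp) y).hasFDerivAt⟩
  refine ⟨e, he, ⟨hx₀, hx, ⟨L, hL.fderiv.symm⟩⟩, fun y hy => (hsrc ▸ hy).2.1, ?_, hder⟩
  intro z hz
  obtain ⟨L', hL'⟩ := hder _ (e.map_target hz)
  refine (e.contDiffAt_symm hz (f₀' := L') ?_ ?_).contDiffWithinAt
  · rwa [he]
  · rw [he]; exact hΦ.contDiffAt

variable {V : Type*} [NormedAddCommGroup V] [InnerProductSpace ℝ V]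

section Tangent

variable {G : Type*} [NormedAddCommGroup G] [NormedSpace ℝ G]

/-- The smooth curves whose velocities span the tangent space. -/
structure IsCurveThrough (M : Set V) (x v : V) (γ : ℝ → V) : Prop where
  smooth : ContDiffAt ℝ ∞ γ 0
  zero : γ 0 = x
  mem : ∀ᶠ t in 𝓝 (0 : ℝ), γ t ∈ M
  deriv : deriv γ 0 = v

theorem IsCurveThrough.hasDerivAt {M : Set V} {x v : V} {γ : ℝ → V}
    (h : IsCurveThrough M x v γ) : HasDerivAt γ v 0 :=
  h.deriv ▸ (h.smooth.differentiableAt (by simp)).hasDerivAt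

theorem IsCurveThrough.tendsto {M : Set V} {x v : V} {γ : ℝ → V}
    (h : IsCurveThrough M x v γ) : Tendsto γ (𝓝 0) (𝓝[M] x) :=
  tendsto_nhdsWithin_iff.2 ⟨h.zero ▸ h.smooth.continuousAt, h.mem⟩

theorem IsCurveThrough.mem_tangentSpace {M : Set V} {x v : V} {γ : ℝ → V}
    (h : IsCurveThrough M x v γ) : v ∈ tangentSpace M x :=
  Submodule.subset_span ⟨γ, h.smooth, h.zero, h.mem, h.deriv⟩

theorem IsCurveThrough.comp_hasDerivAt {M : Set V} {x v : V} {γ : ℝ → V}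
    (h : IsCurveThrough M x v γ) {Φ : V → G} {Φ' : V →L[ℝ] G}
    (hΦ : HasFDerivWithinAt Φ Φ' M x) : HasDerivAt (Φ ∘ γ) (Φ' v) 0 :=
  hΦ.comp_hasDerivAt_of_eq 0 h.hasDerivAt h.mem h.zero.symm

/-- Linear statements about tangent vectors need only be checked on velocities. -/
theorem tangentSpace_le_iff {M : Set V} {x : V} {P : Submodule ℝ V} :
    tangentSpace M x ≤ P ↔ ∀ v γ, IsCurveThrough M x v γ → v ∈ P := by
  refine ⟨fun h v γ hγ => h hγ.mem_tangentSpace, fun h => Submodule.span_le.2 ?_⟩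
  rintro v ⟨γ, h1, h2, h3, h4⟩
  exact h v γ ⟨h1, h2, h3, h4⟩

theorem hasFDerivWithinAt_unique_tangentSpace {M : Set V} {x v : V} {Φ : V → G}
    {Φ' Φ'' : V →L[ℝ] G} (h' : HasFDerivWithinAt Φ Φ' M x) (h'' : HasFDerivWithinAt Φ Φ'' M x)
    (hv : v ∈ tangentSpace M x) : Φ' v = Φ'' v := by
  have : tangentSpace M x ≤ (Φ' - Φ'').ker := tangentSpace_le_iff.2 fun v γ hγ => by
    simpa [sub_eq_zero] using (hγ.comp_hasDerivAt h').unique (hγ.comp_hasDerivAt h'')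
  simpa [sub_eq_zero] using this hv

theorem differential_apply {M : Set V} {x : V} {Φ : V → G} {Φ' : V →L[ℝ] G}
    (h' : HasFDerivWithinAt Φ Φ' M x) (v : tangentSpace M x) : differential M Φ x v = Φ' v :=
  hasFDerivWithinAt_unique_tangentSpace h'.differentiableWithinAt.hasFDerivWithinAt h' v.2

theorem IsCurveThrough.map {M : Set V} {x v : V} {γ : ℝ → V} (h : IsCurveThrough M x v γ)
    (σ : V →L[ℝ] V) (hσ : ∀ y ∈ M, σ y ∈ M) : IsCurveThrough M (σ x) (σ v) (σ ∘ γ) where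
  smooth := σ.contDiff.contDiffAt.comp 0 h.smooth
  zero := by simp [h.zero]
  mem := h.mem.mono fun t ht => hσ _ ht
  deriv := (σ.hasFDerivAt.comp_hasDerivAt 0 h.hasDerivAt).deriv

theorem map_mem_tangentSpace {M : Set V} {x v : V} (σ : V →L[ℝ] V) (hσ : ∀ y ∈ M, σ y ∈ M)
    (hv : v ∈ tangentSpace M x) : σ v ∈ tangentSpace M (σ x) :=
  (tangentSpace_le_iff (P := (tangentSpace M (σ x)).comap (σ : V →ₗ[ℝ] V))).2
    (fun _ _ hγ => (hγ.map σ hσ).mem_tangentSpace) hv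

end Tangent

/-- `M` is locally, within the open set `O`, a level set of `G`, all of whose points are regular
points of `G`. -/
structure IsRegularLevelSet {k : ℕ} (M O : Set V) (G : V → Fin k → ℝ) : Prop where
  isOpen : IsOpen O
  contDiff : ContDiff ℝ ∞ G
  mem_iff : ∀ x ∈ M, ∀ y, y ∈ M ↔ y ∈ O ∧ G y = G x
  surjective : ∀ x ∈ M, Function.Surjective (fderiv ℝ G x)

namespace IsRegularLevelSet

variable [FiniteDimensional ℝ V] {k : ℕ} {M O : Set V} {G : V → Fin k → ℝ}

/-- A chart straightening a regular level set, with derivative the identity at the given point. -/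
theorem exists_chart (h : IsRegularLevelSet M O G) {x : V} (hx : x ∈ M) :
    ∃ e : OpenPartialHomeomorph V V, x ∈ e.source ∧ ContDiff ℝ ∞ e ∧
      ContDiffOn ℝ ∞ e.symm e.target ∧ e x = 0 ∧
      HasFDerivAt e (ContinuousLinearMap.id ℝ V) x ∧
      (∀ y ∈ e.source, y ∈ M ↔ e y ∈ (fderiv ℝ G x).ker) ∧
      ∀ y ∈ e.source, (∃ L : V ≃L[ℝ] V, HasFDerivAt e (L : V →L[ℝ] V) y) ∧
        ∀ v, fderiv ℝ G y v = fderiv ℝ G x (fderiv ℝ e y v) := by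
  set D := fderiv ℝ G x with hD
  obtain ⟨R, hR⟩ := D.exists_rightInverse_of_surjective
    (LinearMap.range_eq_top.2 (h.surjective x hx))
  have hDR : ∀ z, D (R z) = z := fun z => DFunLike.congr_fun hR z
  -- The correction term vanishes to first order at `x`, so the derivative there is the identity,
  -- while `D ∘ R = id` gives `D (Φ y) = G y - G x`: the level set becomes the kernel of `D`.
  set Φ : V → V := fun y => (y - x) + R (G y - G x - D (y - x)) with hΦ
  have hsm : ContDiff ℝ ∞ Φ := by
    have := h.contDiff
    fun_prop
  have hder : ∀ y, HasFDerivAt Φ (ContinuousLinearMap.id ℝ V + R ∘L (fderiv ℝ G y - D)) y := by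
    intro y
    have hG := (h.contDiff.differentiable (by simp) y).hasFDerivAt
    have h1 : HasFDerivAt (fun y => y - x) (ContinuousLinearMap.id ℝ V) y :=
      (hasFDerivAt_id y).sub_const x
    have h2 := (hG.sub_const (G x)).sub (D.hasFDerivAt.comp y h1)
    exact h1.add (R.hasFDerivAt.comp y h2)
  have hderx : HasFDerivAt Φ (ContinuousLinearMap.id ℝ V) x := by
    have := hder x
    rwa [← hD, sub_self, ContinuousLinearMap.comp_zero, add_zero] at this
  obtain ⟨e, he, hxe, heO, hes, hei⟩ := exists_smooth_local_inverse hsm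
    (ContinuousLinearEquiv.refl ℝ V) hderx h.isOpen ((h.mem_iff x hx x).1 hx).1
  refine ⟨e, hxe, he ▸ hsm, hes, by simp [he, hΦ], he ▸ hderx, ?_, ?_⟩
  · intro y hy
    rw [h.mem_iff x hx y, he, LinearMap.mem_ker]
    have : D (Φ y) = G y - G x := by simp [hΦ, hDR]
    simp [this, sub_eq_zero, heO hy]
  · intro y hy
    refine ⟨he ▸ hei y hy, fun v => ?_⟩
    rw [he, (hder y).fderiv]
    simp [hDR]

theorem isSubmanifold (h : IsRegularLevelSet M O G) {d : ℕ}
    (hd : d + k = Module.finrank ℝ V) : IsSubmanifold M d := by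
  intro x hx
  obtain ⟨e, hxe, he, hes, -, -, hM, -⟩ := h.exists_chart hx
  refine ⟨(fderiv ℝ G x).ker, e, ?_, hxe, he.contDiffOn, hes, hM⟩
  have h1 := LinearMap.finrank_range_add_finrank_ker (fderiv ℝ G x : V →ₗ[ℝ] Fin k → ℝ)
  rw [LinearMap.range_eq_top.2 (h.surjective x hx), finrank_top, Module.finrank_fin_fun] at h1
  have h2 : Module.finrank ℝ (fderiv ℝ G x).ker =
    Module.finrank ℝ (LinearMap.ker (fderiv ℝ G x : V →ₗ[ℝ] Fin k → ℝ)) := rfl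
  omega

/-- The curve is the line `t • v` in the kernel, carried back by the chart; as the chart has
derivative the identity at `x`, the velocity is `v` itself. -/
theorem exists_curve (h : IsRegularLevelSet M O G) {x v : V} (hx : x ∈ M)
    (hv : fderiv ℝ G x v = 0) : ∃ γ, IsCurveThrough M x v γ := by
  obtain ⟨e, hxe, he, hes, he0, hid, hM, -⟩ := h.exists_chart hx
  have h0 : (0 : V) ∈ e.target := he0 ▸ e.map_source hxe
  have hs0 : e.symm 0 = x := by rw [← he0, e.left_inv hxe]
  have hline : HasDerivAt (fun t : ℝ => t • v) v 0 := by
    simpa using (hasDerivAt_id (0 : ℝ)).smul_const v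
  have hsymm : HasFDerivAt e.symm (ContinuousLinearMap.id ℝ V) 0 :=
    e.hasFDerivAt_symm (f' := ContinuousLinearEquiv.refl ℝ V) h0 (by rw [hs0]; exact hid)
  refine ⟨fun t => e.symm (t • v), ?_, by simp [hs0], ?_, ?_⟩
  · refine ContDiffAt.comp 0 (g := e.symm) ?_ (by fun_prop)
    rw [zero_smul]
    exact (hes 0 h0).contDiffAt (e.open_target.mem_nhds h0)
  · have : ∀ᶠ t in 𝓝 (0 : ℝ), t • v ∈ e.target :=
      hline.continuousAt.eventually_mem (by simpa using e.open_target.mem_nhds h0)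
    filter_upwards [this] with t ht
    rw [hM _ (e.map_target ht), e.right_inv ht]
    simp [hv]
  · have := HasFDerivAt.comp_hasDerivAt_of_eq (0 : ℝ) hsymm hline (by simp)
    exact this.deriv

theorem tangentSpace_eq (h : IsRegularLevelSet M O G) {x : V} (hx : x ∈ M) :
    tangentSpace M x = (fderiv ℝ G x).ker := by
  refine le_antisymm (tangentSpace_le_iff.2 fun v γ hγ => ?_) fun v hv => ?_
  · have h1 := hγ.comp_hasDerivAt
      (h.contDiff.differentiable (by simp) x).hasFDerivAt.hasFDerivWithinAt
    have h2 : (G ∘ γ) =ᶠ[𝓝 0] fun _ => G x :=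
      hγ.mem.mono fun t ht => ((h.mem_iff x hx _).1 ht).2
    exact (h1.congr_of_eventuallyEq h2.symm).unique (hasDerivAt_const (0 : ℝ) (G x))
  · obtain ⟨γ, hγ⟩ := h.exists_curve hx hv
    exact hγ.mem_tangentSpace

/-- The tangential part of the derivative of a normal field that vanishes at `x` vanishes
at `x`. -/
theorem inner_fderivWithin_eq_zero (h : IsRegularLevelSet M O G) {x : V} (hx : x ∈ M)
    {ζ : V → V} {ζ' : V →L[ℝ] V} (hζ : HasFDerivWithinAt ζ ζ' M x) (h0 : ζ x = 0)
    (hn : ∀ᶠ y in 𝓝[M] x, ζ y ∈ (tangentSpace M y)ᗮ) {X Y : V}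
    (hX : X ∈ tangentSpace M x) (hY : Y ∈ tangentSpace M x) : inner ℝ (ζ' X) Y = 0 := by
  suffices tangentSpace M x ≤ ((innerSL ℝ Y) ∘L ζ').ker by
    rw [real_inner_comm]
    simpa using this hX
  refine tangentSpace_le_iff.2 fun v γ hγ => ?_
  obtain ⟨e, hxe, he, -, -, hid, -, hL⟩ := h.exists_chart hx
  -- `Z` extends `Y` to a tangent field near `x`: it is the constant field `Y` pulled back through
  -- the chart.
  let Z : V → V := fun y => (fderiv ℝ e y).inverse Y
  have hZc : Tendsto Z (𝓝 x) (𝓝 Y) := by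
    have h1 : ContinuousAt (ContinuousLinearMap.inverse : (V →L[ℝ] V) → V →L[ℝ] V)
        (fderiv ℝ e x) := by
      rw [hid.fderiv]
      exact (contDiffAt_map_inverse (n := ∞) (ContinuousLinearEquiv.refl ℝ V)).continuousAt
    have h2 : ContinuousAt (fderiv ℝ e) x := (he.continuous_fderiv (by simp)).continuousAt
    have h3 : ContinuousAt Z x := (h1.comp h2).clm_apply continuousAt_const
    have h4 : Z x = Y := by
      simp only [Z, hid.fderiv]
      exact DFunLike.congr_fun
          (ContinuousLinearMap.inverse_equiv (ContinuousLinearEquiv.refl ℝ V)) Y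
    have := h3.tendsto
    rwa [h4] at this
  have hYker : fderiv ℝ G x Y = 0 := by
    rw [h.tangentSpace_eq hx] at hY
    exact hY
  have hZt : ∀ᶠ y in 𝓝[M] x, Z y ∈ tangentSpace M y := by
    filter_upwards [self_mem_nhdsWithin, mem_nhdsWithin_of_mem_nhds (e.open_source.mem_nhds hxe)]
      with y hyM hye
    rw [h.tangentSpace_eq hyM]
    change fderiv ℝ G y (Z y) = 0
    obtain ⟨⟨L, hLy⟩, hG⟩ := hL y hye
    rw [hG, ← hYker]
    congr 1
    simp [Z, hLy.fderiv]
  have hzero : ∀ᶠ t in 𝓝 (0 : ℝ), inner ℝ (Z (γ t)) (ζ (γ t)) = 0 := by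
    filter_upwards [hγ.tendsto.eventually hn, hγ.tendsto.eventually hZt] with t h1 h2
    exact h1 _ h2
  -- Since `ζ x = 0`, the difference quotient of `ζ` along `γ` is a multiple of `ζ (γ t)`, hence
  -- orthogonal to `Z (γ t)`; in the limit only the continuity of `Z` is needed.
  have h1 := hasDerivAt_iff_tendsto_slope_zero.1 (hγ.comp_hasDerivAt hζ)
  have h2 : Tendsto (fun t => Z (γ t)) (𝓝[≠] 0) (𝓝 Y) :=
    hZc.comp ((tendsto_nhds_of_tendsto_nhdsWithin hγ.tendsto).mono_left nhdsWithin_le_nhds)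
  have h3 := h2.inner (𝕜 := ℝ) h1
  refine tendsto_nhds_unique h3 (tendsto_const_nhds.congr' ?_)
  filter_upwards [nhdsWithin_le_nhds hzero] with t ht
  simp [hγ.zero, h0, inner_smul_right, ht]

end IsRegularLevelSet

section Orientation

theorem _root_.ContDiffOn.curryLeft {M : Set V} {n : ℕ} {η : V → V [⋀^Fin (n + 1)]→L[ℝ] ℝ}
    (hη : ContDiffOn ℝ ∞ η M) {a : V → V} (ha : ContDiffOn ℝ ∞ a M) :
    ContDiffOn ℝ ∞ (fun x => (η x).curryLeft (a x)) M := by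
  have hb : IsBoundedBilinearMap ℝ fun q : (V [⋀^Fin (n + 1)]→L[ℝ] ℝ) × V =>
      q.1.curryLeft q.2 :=
    { add_left := fun f g v => by simp
      smul_left := fun r f v => by simp
      add_right := fun f v w => map_add _ v w
      smul_right := fun r f v => map_smul _ r v
      bound := ⟨1, one_pos, fun f v => by
        rw [one_mul, ← ContinuousAlternatingMap.norm_curryLeft f]
        exact f.curryLeft.le_opNorm v⟩ }
  exact hb.contDiff.comp_contDiffOn (hη.prodMk ha)

/-- Repeated interior multiplication by the fields `a i`. Only the range of the argument list is
recorded: nonvanishing of a volume form depends on whether the arguments span, not on their order.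
-/
theorem exists_curried_form {M : Set V} {d : ℕ} : ∀ (k : ℕ) (η : V → V [⋀^Fin (d + k)]→L[ℝ] ℝ)
    (_ : ContDiffOn ℝ ∞ η M) (a : Fin k → V → V) (_ : ∀ i, ContDiffOn ℝ ∞ (a i) M),
    ∃ η' : V → V [⋀^Fin d]→L[ℝ] ℝ, ContDiffOn ℝ ∞ η' M ∧ ∀ x v, ∃ w : Fin (d + k) → V,
      η' x v = η x w ∧ Set.range w = Set.range v ∪ Set.range fun i => a i x
  | 0, η, hη, _, _ => ⟨η, hη, fun _ v => ⟨v, rfl, by simp⟩⟩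
  | k + 1, η, hη, a, ha => by
    let η₁ : V → V [⋀^Fin (d + k)]→L[ℝ] ℝ := fun x => (η x).curryLeft (a 0 x)
    have hη₁ : ContDiffOn ℝ ∞ η₁ M := hη.curryLeft (n := d + k) (ha 0)
    obtain ⟨η', h1, h2⟩ := exists_curried_form k η₁ hη₁ (fun i => a i.succ) fun i => ha _
    refine ⟨η', h1, fun x v => ?_⟩
    obtain ⟨w, hw, hr⟩ := h2 x v
    refine ⟨Matrix.vecCons (a 0 x) w, hw, ?_⟩
    rw [Matrix.range_cons, hr]
    ext y
    simp only [Set.mem_union, Set.mem_range, Set.mem_singleton_iff, Fin.exists_fin_succ]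
    tauto

variable [FiniteDimensional ℝ V]

/-- A subset whose tangent spaces are the orthogonal complements of a smooth global normal frame is
orientable. -/
theorem isOrientable_of_normalFrame {M : Set V} {d k : ℕ} (hd : d + k = Module.finrank ℝ V)
    (a : Fin k → V → V) (ha : ∀ i, ContDiffOn ℝ ∞ (a i) M)
    (hli : ∀ x ∈ M, LinearIndependent ℝ fun i => a i x)
    (hT : ∀ x ∈ M, tangentSpace M x = (Submodule.span ℝ (Set.range fun i => a i x))ᗮ) :
    IsOrientable M d := by
  let b := Module.finBasisOfFinrankEq ℝ V hd.symm
  let vol : V [⋀^Fin (d + k)]→L[ℝ] ℝ :=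
    { b.det with
      cont := by
        change Continuous fun v => b.det v
        simp only [Module.Basis.det_apply]
        refine Continuous.matrix_det (continuous_matrix fun i j => ?_)
        exact (LinearMap.continuous_of_finiteDimensional (b.coord i)).comp (continuous_apply j) }
  obtain ⟨η, hη, hη'⟩ := exists_curried_form k (fun _ : V => vol) contDiffOn_const a ha
  refine ⟨η, hη, fun x hx => ?_⟩
  set P := Submodule.span ℝ (Set.range fun i => a i x)
  have hP : Module.finrank ℝ P = k := by
    simpa using finrank_span_eq_card (hli x hx)
  have hPd : Module.finrank ℝ Pᗮ = d := by
    have := P.finrank_add_finrank_orthogonal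
    omega
  let c := Module.finBasisOfFinrankEq ℝ Pᗮ hPd
  refine ⟨fun i => c i, fun i => by rw [hT x hx]; exact (c i).2, ?_⟩
  obtain ⟨w, hw, hr⟩ := hη' x fun i => (c i : V)
  rw [hw]
  change b.det w ≠ 0
  -- A basis of the tangent space and the normal frame together span `V`, so the volume form does
  -- not vanish on them.
  have hspan : ⊤ ≤ Submodule.span ℝ (Set.range w) := by
    rw [hr, Submodule.span_union]
    have h1 : Submodule.span ℝ (Set.range fun i => (c i : V)) = Pᗮ := by
      have := congrArg (Submodule.map Pᗮ.subtype) c.span_eq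
      rw [Submodule.map_span, ← Set.range_comp, Submodule.map_top, Submodule.range_subtype] at this
      exact this
    rw [h1, sup_comm]
    exact (Submodule.sup_orthogonal_of_hasOrthogonalProjection).ge
  have hli' : LinearIndependent ℝ w :=
    linearIndependent_of_top_le_span_of_card_eq_finrank hspan (by simp [hd])
  simpa using (Module.Basis.isUnit_det b (Module.Basis.mk hli' hspan)).ne_zero

end Orientation

end EuclideanSubmanifold

/-! ### Austerity from isometric involutions. -/

namespace EuclideanSubmanifold

open Filter Topology

namespace IsRegularLevelSet

variable {V : Type*} [NormedAddCommGroup V] [InnerProductSpace ℝ V] [FiniteDimensional ℝ V]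
  {k : ℕ} {M O : Set V} {G : V → Fin k → ℝ}

/-- If an isometric involution of `M` fixes `x` and reverses the normal vector `ξ x`, then it
conjugates the shape operator to its negative. -/
theorem inner_fderivWithin_involution (h : IsRegularLevelSet M O G) {x : V} (hx : x ∈ M)
    (σ : V →L[ℝ] V) (hσM : ∀ y ∈ M, σ y ∈ M) (hσσ : ∀ y, σ (σ y) = y)
    (hσ : ∀ y z, inner ℝ (σ y) z = inner ℝ y (σ z)) (hσx : σ x = x) {U : Set V} (hU : IsOpen U)
    (hxU : x ∈ U) {ξ : V → V} {ξ' : V →L[ℝ] V} (hξ' : HasFDerivWithinAt ξ ξ' M x)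
    (hn : ∀ y ∈ M ∩ U, ξ y ∈ (tangentSpace M y)ᗮ) (hξx : σ (ξ x) = -ξ x) {X Y : V}
    (hX : X ∈ tangentSpace M x) (hY : Y ∈ tangentSpace M x) :
    inner ℝ (ξ' (σ X)) Y = -inner ℝ (ξ' X) (σ Y) := by
  have hσY : σ Y ∈ tangentSpace M x := by
    simpa [hσx] using map_mem_tangentSpace σ hσM hY
  have hmaps : Set.MapsTo σ M M := fun y hy => hσM y hy
  -- The field `ξ + σ ∘ ξ ∘ σ` is again normal and vanishes at `x`, because `σ` reverses `ξ x`. So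
  -- its derivative has no tangential part; testing against `σ Y` and using `σ ∘ σ = id` gives the
  -- claim.
  have h1 : HasFDerivWithinAt (fun y => ξ y + σ (ξ (σ y))) (ξ' + σ ∘L ξ' ∘L σ) M x := by
    refine hξ'.add (σ.hasFDerivAt.comp_hasFDerivWithinAt x ?_)
    refine HasFDerivWithinAt.comp x ?_ σ.hasFDerivAt.hasFDerivWithinAt hmaps
    rwa [hσx]
  have h2 := h.inner_fderivWithin_eq_zero hx h1 (by simp [hσx, hξx]) ?_ hX hσY
  · simp only [add_apply, ContinuousLinearMap.comp_apply, inner_add_left, hσ,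
      hσσ] at h2
    linarith
  · have hU' : ∀ᶠ y in 𝓝[M] x, y ∈ U ∧ σ y ∈ U := by
      refine mem_nhdsWithin_of_mem_nhds (inter_mem (hU.mem_nhds hxU) ?_)
      exact σ.continuous.continuousAt.preimage_mem_nhds (hU.mem_nhds (by rwa [hσx]))
    filter_upwards [self_mem_nhdsWithin, hU'] with y hyM hyU
    refine Submodule.add_mem _ (hn y ⟨hyM, hyU.1⟩) fun t ht => ?_
    rw [← hσ]
    exact hn (σ y) ⟨hσM y hyM, hyU.2⟩ (σ t) (map_mem_tangentSpace σ hσM ht)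

/-- The restriction of `σ` to the tangent space anticommutes with the shape operator, so it maps the
eigenspace of `c` injectively into that of `-c`; the same for `-c` gives equality. -/
theorem finrank_eigenspace_shapeOperator_neg (h : IsRegularLevelSet M O G) {x : V} (hx : x ∈ M)
    (σ : V →L[ℝ] V) (hσM : ∀ y ∈ M, σ y ∈ M) (hσσ : ∀ y, σ (σ y) = y)
    (hσ : ∀ y z, inner ℝ (σ y) z = inner ℝ y (σ z)) (hσx : σ x = x) {U : Set V} (hU : IsOpen U)
    (hxU : x ∈ U) {ξ : V → V} (hξ : ContDiffOn ℝ ∞ ξ (M ∩ U))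
    (hn : ∀ y ∈ M ∩ U, ξ y ∈ (tangentSpace M y)ᗮ) (hξx : σ (ξ x) = -ξ x) (c : ℝ) :
    Module.finrank ℝ (Module.End.eigenspace
        (shapeOperator M ξ x : Module.End ℝ (tangentSpace M x)) c) =
      Module.finrank ℝ (Module.End.eigenspace
        (shapeOperator M ξ x : Module.End ℝ (tangentSpace M x)) (-c)) := by
  obtain ⟨ξ', hξ'⟩ := (hξ.differentiableOn (by simp)) x ⟨hx, hxU⟩
  replace hξ' : HasFDerivWithinAt ξ ξ' M x :=
    hξ'.mono_of_mem_nhdsWithin (inter_mem_nhdsWithin M (hU.mem_nhds hxU))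
  have hσT : ∀ Y ∈ tangentSpace M x, σ Y ∈ tangentSpace M x := fun Y hY => by
    simpa [hσx] using map_mem_tangentSpace σ hσM hY
  let τ : tangentSpace M x →ₗ[ℝ] tangentSpace M x := (σ : V →ₗ[ℝ] V).restrict hσT
  have hinner : ∀ X Y : tangentSpace M x,
      inner ℝ (shapeOperator M ξ x X) Y = -inner ℝ (ξ' X) (Y : V) := by
    intro X Y
    simp only [shapeOperator, neg_apply, ContinuousLinearMap.comp_apply,
      inner_neg_left, differential_apply hξ']
    rw [Submodule.inner_orthogonalProjectionOnto_eq_of_mem_right]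
  have hanti : ∀ X, shapeOperator M ξ x (τ X) = -τ (shapeOperator M ξ x X) := by
    refine fun X => ext_inner_right ℝ fun Y => ?_
    have h1 : inner ℝ (τ (shapeOperator M ξ x X)) Y = inner ℝ (shapeOperator M ξ x X) (τ Y) :=
      hσ _ _
    rw [inner_neg_left, h1, hinner, hinner]
    have := h.inner_fderivWithin_involution hx σ hσM hσσ hσ hσx hU hxU hξ' hn hξx X.2 Y.2
    simp only [τ, LinearMap.coe_restrict_apply, ContinuousLinearMap.coe_coe, this]
  have hle : ∀ c : ℝ, Module.finrank ℝ (Module.End.eigenspace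
        (shapeOperator M ξ x : Module.End ℝ (tangentSpace M x)) c) ≤
      Module.finrank ℝ (Module.End.eigenspace
        (shapeOperator M ξ x : Module.End ℝ (tangentSpace M x)) (-c)) := by
    intro c
    have hmap : ∀ X ∈ Module.End.eigenspace
        (shapeOperator M ξ x : Module.End ℝ (tangentSpace M x)) c,
        τ X ∈ Module.End.eigenspace
          (shapeOperator M ξ x : Module.End ℝ (tangentSpace M x)) (-c) := by
      intro X hX
      rw [Module.End.mem_eigenspace_iff, ContinuousLinearMap.coe_coe] at hX ⊢
      rw [hanti, hX, map_smul, neg_smul]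
    refine LinearMap.finrank_le_finrank_of_injective (f := τ.restrict hmap) fun X Y hXY => ?_
    have h1 : σ ((X : tangentSpace M x) : V) = σ ((Y : tangentSpace M x) : V) :=
      congrArg (fun Z => ((Z : tangentSpace M x) : V)) (congrArg Subtype.val hXY)
    have h2 := congrArg σ h1
    rw [hσσ, hσσ] at h2
    exact Subtype.ext (Subtype.ext h2)
  exact le_antisymm (hle c) ((hle (-c)).trans_eq (by rw [neg_neg]))

end IsRegularLevelSet

end EuclideanSubmanifold

/-! ### Matrix algebra common to `ℝ`, `ℂ`, `ℍ`. -/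

namespace HermitianSphere

open EuclideanSubmanifold Filter Topology Matrix

/-- The properties of `ℝ`, `ℂ`, `ℍ` that are used: a real algebra with conjugation, whose inner
product is `⟪a, b⟫ = Re (a * star b)` with `Re a = ⟪1, a⟫` tracial, and whose self-adjoint elements
are real. -/
class HermitianAlgebra (F : Type*) [NormedRing F] [StarRing F] [InnerProductSpace ℝ F] : Prop
    extends IsScalarTower ℝ F F, SMulCommClass ℝ F F where
  inner_eq (a b : F) : inner ℝ a b = inner ℝ 1 (a * star b)
  re_mul_comm (a b : F) : inner ℝ 1 (a * b) = inner ℝ 1 (b * a)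
  eq_re_smul_one (a : F) : star a = a → a = (inner ℝ 1 a : ℝ) • (1 : F)
  norm_one : ‖(1 : F)‖ = 1

instance : HermitianAlgebra ℝ where
  inner_eq a b := by simp [mul_comm]
  re_mul_comm a b := by simp [mul_comm]
  eq_re_smul_one a _ := by simp
  norm_one := by simp

instance : HermitianAlgebra ℂ where
  inner_eq a b := by simp [Complex.inner, mul_comm]
  re_mul_comm a b := by simp [mul_comm]
  eq_re_smul_one a h := by
    have : a.im = 0 := Complex.conj_eq_iff_im.1 h
    apply Complex.ext <;> simp [Complex.inner, this]
  norm_one := by simp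

instance : HermitianAlgebra ℍ[ℝ] where
  inner_eq a b := by
    simp [Quaternion.inner_def]
    ring
  re_mul_comm a b := by
    simp [Quaternion.inner_def]
    ring
  eq_re_smul_one a h := by
    rw [Quaternion.star_eq_self] at h
    simp only [Quaternion.inner_def, one_mul, Quaternion.re_star]
    nth_rewrite 1 [h]
    ext <;> simp
  norm_one := by simp

variable {n : ℕ} {F : Type*} [NormedRing F] [InnerProductSpace ℝ F]

theorem frobenius_norm_sq (A : Matrix (Fin n) (Fin n) F) : ‖A‖ ^ 2 = ∑ i, ∑ j, ‖A i j‖ ^ 2 := by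
  rw [← real_inner_self_eq_norm_sq]
  exact Finset.sum_congr rfl fun i _ => Finset.sum_congr rfl fun j _ =>
    real_inner_self_eq_norm_sq _

theorem frobenius_norm_mul_le (A B : Matrix (Fin n) (Fin n) F) : ‖A * B‖ ≤ ‖A‖ * ‖B‖ := by
  refine abs_le_of_sq_le_sq' ?_ (by positivity) |>.2
  rw [mul_pow, frobenius_norm_sq, frobenius_norm_sq, frobenius_norm_sq, Finset.sum_mul]
  refine Finset.sum_le_sum fun i _ => ?_
  rw [Finset.sum_comm (f := fun i j => ‖B i j‖ ^ 2), Finset.mul_sum]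
  refine Finset.sum_le_sum fun j _ => ?_
  refine le_trans ?_ (Finset.sum_mul_sq_le_sq_mul_sq
      Finset.univ (fun k => ‖A i k‖) fun k => ‖B k j‖)
  refine pow_le_pow_left₀ (norm_nonneg _) ?_ 2
  rw [Matrix.mul_apply]
  exact (norm_sum_le _ _).trans (Finset.sum_le_sum fun k _ => norm_mul_le _ _)

/-- Square matrices over `F` form a normed ring for the Frobenius norm. -/
@[reducible]
def matrixNormedRing : NormedRing (Matrix (Fin n) (Fin n) F) :=
  { Matrix.frobeniusNormedAddCommGroup, Matrix.instRing with
    norm_mul_le := frobenius_norm_mul_le }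

/-- Square matrices over `F` form a real algebra. -/
@[reducible]
def matrixAlgebra [IsScalarTower ℝ F F] [SMulCommClass ℝ F F] :
    Algebra ℝ (Matrix (Fin n) (Fin n) F) :=
  Algebra.ofModule (fun r A B => Matrix.smul_mul r A B) (fun r A B => Matrix.mul_smul A r B)

/-- Square matrices over `F` form a real normed algebra for the Frobenius norm. -/
@[reducible]
def matrixNormedAlgebra [IsScalarTower ℝ F F] [SMulCommClass ℝ F F] :
    @NormedAlgebra ℝ (Matrix (Fin n) (Fin n) F) _ matrixNormedRing.toSeminormedRing :=
  letI := matrixNormedRing (n := n) (F := F)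
  { matrixAlgebra with
    norm_smul_le := fun r A => norm_smul_le r A }

/-- The topology of the Frobenius norm. -/
@[reducible]
def matrixTopology : TopologicalSpace (Matrix (Fin n) (Fin n) F) :=
  Matrix.frobeniusNormedAddCommGroup.toPseudoMetricSpace.toUniformSpace.toTopologicalSpace

attribute [local instance] matrixNormedRing matrixNormedAlgebra matrixTopology

theorem matrixT2Space : T2Space (Matrix (Fin n) (Fin n) F) :=
  @TopologicalSpace.t2Space_of_metrizableSpace _ _
    (@EMetricSpace.metrizableSpace _ (@MetricSpace.toEMetricSpace _ inferInstance))

attribute [local instance] matrixT2Space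

variable [StarRing F] [StarModule ℝ F] [HermitianAlgebra F]

theorem re_star (a : F) : inner ℝ (1 : F) (star a) = inner ℝ 1 a := by
  rw [← one_mul (star a), ← HermitianAlgebra.inner_eq]

/-- The element `a * star a` is self-adjoint, hence equal to its real part. -/
theorem mul_star_self (a : F) : a * star a = (‖a‖ ^ 2) • (1 : F) := by
  rw [← real_inner_self_eq_norm_sq, HermitianAlgebra.inner_eq]
  exact HermitianAlgebra.eq_re_smul_one _ (by simp)

theorem norm_star_eq (a : F) : ‖star a‖ = ‖a‖ := by
  have h : ‖star a‖ ^ 2 = ‖a‖ ^ 2 := by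
    rw [← real_inner_self_eq_norm_sq, ← real_inner_self_eq_norm_sq, HermitianAlgebra.inner_eq,
      HermitianAlgebra.inner_eq a, star_star, HermitianAlgebra.re_mul_comm]
  exact (pow_left_inj₀ (norm_nonneg _) (norm_nonneg _) two_ne_zero).1 h

theorem re_one : inner ℝ (1 : F) 1 = 1 := by
  rw [real_inner_self_eq_norm_sq, HermitianAlgebra.norm_one, one_pow]

variable (n F) in
/-- The real part of the trace. -/
def reTrace : Matrix (Fin n) (Fin n) F →ₗ[ℝ] ℝ :=
  (innerₛₗ ℝ (1 : F)) ∘ₗ Matrix.traceLinearMap (Fin n) ℝ F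

theorem reTrace_apply (A : Matrix (Fin n) (Fin n) F) :
    reTrace n F A = ∑ i, inner ℝ (1 : F) (A i i) := by
  simp [reTrace, Matrix.trace, inner_sum]

/-- Over `ℍ` the trace itself is not cyclic, but its real part is; hence `reTrace` takes the place
of the trace in all computations. -/
theorem reTrace_mul_comm (A B : Matrix (Fin n) (Fin n) F) :
    reTrace n F (A * B) = reTrace n F (B * A) := by
  simp only [reTrace_apply, Matrix.mul_apply, inner_sum]
  rw [Finset.sum_comm]
  simp only [HermitianAlgebra.re_mul_comm]

theorem inner_eq_reTrace (A B : Matrix (Fin n) (Fin n) F) :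
    inner ℝ A B = reTrace n F (A * Bᴴ) := by
  simp only [reTrace_apply, Matrix.mul_apply, inner_sum, Matrix.conjTranspose_apply,
    ← HermitianAlgebra.inner_eq]
  rfl

/-- The real diagonal matrices. -/
def rdiag (a : Fin n → ℝ) : Matrix (Fin n) (Fin n) F := Matrix.diagonal fun i => a i • (1 : F)

theorem rdiag_mul (a b : Fin n → ℝ) : (rdiag (a * b) : Matrix (Fin n) (Fin n) F) =
    rdiag a * rdiag b := by
  simp [rdiag, Matrix.diagonal_mul_diagonal, mul_smul, fun i => smul_comm (a i) (b i) (1 : F)]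

theorem rdiag_one : (rdiag 1 : Matrix (Fin n) (Fin n) F) = 1 := by
  simp [rdiag]

theorem rdiag_pow (a : Fin n → ℝ) (k : ℕ) : (rdiag (a ^ k) : Matrix (Fin n) (Fin n) F) =
    rdiag a ^ k := by
  induction k with
  | zero => simp [rdiag_one]
  | succ k ih => rw [pow_succ, rdiag_mul, ih, pow_succ]

theorem rdiag_smul (r : ℝ) (a : Fin n → ℝ) : (rdiag (r • a) : Matrix (Fin n) (Fin n) F) =
    r • rdiag a := by
  ext i j
  by_cases h : i = j <;> simp [rdiag, h, mul_smul]

theorem rdiag_add (a b : Fin n → ℝ) : (rdiag (a + b) : Matrix (Fin n) (Fin n) F) =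
    rdiag a + rdiag b := by
  simp [rdiag, add_smul, Matrix.diagonal_add]

variable (n F) in
/-- `rdiag` as a linear map. -/
def rdiagₗ : (Fin n → ℝ) →ₗ[ℝ] Matrix (Fin n) (Fin n) F where
  toFun := rdiag
  map_add' := rdiag_add
  map_smul' := rdiag_smul

theorem rdiag_conjTranspose (a : Fin n → ℝ) :
    (rdiag a : Matrix (Fin n) (Fin n) F)ᴴ = rdiag a := by
  simp [rdiag, Matrix.diagonal_conjTranspose]

theorem reTrace_rdiag (a : Fin n → ℝ) :
    reTrace n F (rdiag a) = ∑ i, a i := by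
  simp [reTrace_apply, rdiag, inner_smul_right, HermitianAlgebra.norm_one]

theorem rdiag_injective : Function.Injective (rdiag : _ → Matrix (Fin n) (Fin n) F) := by
  intro a b h
  ext i
  have := congrArg (fun A : Matrix (Fin n) (Fin n) F => inner ℝ (1 : F) (A i i)) h
  simpa [rdiag, inner_smul_right, HermitianAlgebra.norm_one] using this

variable (n F) in
/-- The group of unitary matrices. -/
def unitaries : Set (Matrix (Fin n) (Fin n) F) := {U | U * Uᴴ = 1 ∧ Uᴴ * U = 1}

theorem one_mem_unitaries : (1 : Matrix (Fin n) (Fin n) F) ∈ unitaries n F := by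
  simp [unitaries]

theorem mul_mem_unitaries {U W : Matrix (Fin n) (Fin n) F} (hU : U ∈ unitaries n F)
    (hW : W ∈ unitaries n F) : U * W ∈ unitaries n F := by
  constructor
  · rw [conjTranspose_mul, Matrix.mul_assoc, ← Matrix.mul_assoc W, hW.1, Matrix.one_mul, hU.1]
  · rw [conjTranspose_mul, Matrix.mul_assoc, ← Matrix.mul_assoc Uᴴ, hU.2, Matrix.one_mul, hW.2]

theorem conj_mul {U : Matrix (Fin n) (Fin n) F} (hU : U ∈ unitaries n F)
    (A B : Matrix (Fin n) (Fin n) F) : Uᴴ * (A * B) * U = (Uᴴ * A * U) * (Uᴴ * B * U) := by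
  have : U * (Uᴴ * (B * U)) = B * U := by rw [← Matrix.mul_assoc, hU.1, Matrix.one_mul]
  simp only [Matrix.mul_assoc, this]

theorem conj_pow {U : Matrix (Fin n) (Fin n) F} (hU : U ∈ unitaries n F)
    (A : Matrix (Fin n) (Fin n) F) (k : ℕ) : (Uᴴ * A * U) ^ k = Uᴴ * A ^ k * U := by
  induction k with
  | zero => simp [hU.2]
  | succ k ih => rw [pow_succ, ih, pow_succ, conj_mul hU]

theorem conj_conjTranspose (U A : Matrix (Fin n) (Fin n) F) : (Uᴴ * A * U)ᴴ = Uᴴ * Aᴴ * U := by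
  simp [Matrix.mul_assoc]

theorem reTrace_conj {U : Matrix (Fin n) (Fin n) F} (hU : U ∈ unitaries n F)
    (A : Matrix (Fin n) (Fin n) F) : reTrace n F (Uᴴ * A * U) = reTrace n F A := by
  rw [Matrix.mul_assoc, reTrace_mul_comm, Matrix.mul_assoc, hU.1, Matrix.mul_one]

theorem conj_injective {U : Matrix (Fin n) (Fin n) F} (hU : U ∈ unitaries n F) :
    Function.Injective fun A : Matrix (Fin n) (Fin n) F => Uᴴ * A * U := by
  intro A B h
  have := congrArg (fun X => U * X * Uᴴ) h
  have e : ∀ X : Matrix (Fin n) (Fin n) F, U * (Uᴴ * X * U) * Uᴴ = X := fun X => by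
    rw [Matrix.mul_assoc Uᴴ, ← Matrix.mul_assoc U, hU.1, Matrix.one_mul, Matrix.mul_assoc, hU.1,
      Matrix.mul_one]
  simpa only [e] using this

theorem continuous_conjTranspose :
    Continuous fun A : Matrix (Fin n) (Fin n) F => Aᴴ := by
  refine AddMonoidHomClass.continuous_of_bound (Matrix.conjTransposeAddEquiv (Fin n) (Fin n) F) 1
    fun A => le_of_eq ?_
  rw [one_mul, ← sq_eq_sq₀ (norm_nonneg _) (norm_nonneg _), frobenius_norm_sq, frobenius_norm_sq,
    Finset.sum_comm]
  simp [norm_star_eq]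

end HermitianSphere

/-! ### The spectral theorem with unitaries in the identity component. -/

namespace HermitianSphere

open EuclideanSubmanifold Filter Topology Matrix

variable {n : ℕ} {F : Type*} [NormedRing F] [InnerProductSpace ℝ F]

attribute [local instance] matrixNormedRing matrixNormedAlgebra matrixTopology
  matrixT2Space

variable [StarRing F] [StarModule ℝ F] [HermitianAlgebra F]

/-- The rotation by the angle `θ` generated by a skew-Hermitian matrix `Z` with `Z ^ 3 = -Z`. -/
def rotation (Z : Matrix (Fin n) (Fin n) F) (θ : ℝ) : Matrix (Fin n) (Fin n) F :=
  1 + Real.sin θ • Z + (1 - Real.cos θ) • (Z * Z)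

theorem rotation_conjTranspose {Z : Matrix (Fin n) (Fin n) F} (hZ : Zᴴ = -Z) (θ : ℝ) :
    (rotation Z θ)ᴴ = rotation Z (-θ) := by
  simp [rotation, hZ, Matrix.conjTranspose_smul]

/-- For `Z ^ 3 = -Z`, `rotation Z θ` is the closed form of `exp (θ Z)`; the identity then comes down
to `sin² + cos² = 1`. -/
theorem rotation_mul_neg {Z : Matrix (Fin n) (Fin n) F} (hZ3 : Z * Z * Z = -Z) (θ : ℝ) :
    rotation Z θ * rotation Z (-θ) = 1 := by
  have h4 : Z * Z * (Z * Z) = -(Z * Z) := by rw [← Matrix.mul_assoc, hZ3, Matrix.neg_mul]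
  have h3 : Z * (Z * Z) = -Z := by rw [← Matrix.mul_assoc, hZ3]
  have hsc := Real.sin_sq_add_cos_sq θ
  simp only [rotation, Real.sin_neg, Real.cos_neg, mul_add, add_mul, mul_one, one_mul,
    smul_mul_assoc, mul_smul_comm, hZ3, h3, h4]
  match_scalars <;> first | ring1 | linear_combination -hsc

theorem rotation_mem_unitaries {Z : Matrix (Fin n) (Fin n) F} (hZ : Zᴴ = -Z)
    (hZ3 : Z * Z * Z = -Z) (θ : ℝ) : rotation Z θ ∈ unitaries n F := by
  refine ⟨?_, ?_⟩
  · rw [rotation_conjTranspose hZ, rotation_mul_neg hZ3]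
  · rw [rotation_conjTranspose hZ]
    simpa using rotation_mul_neg hZ3 (-θ)

theorem continuous_rotation (Z : Matrix (Fin n) (Fin n) F) : Continuous (rotation Z) := by
  unfold rotation
  fun_prop

theorem rotation_zero (Z : Matrix (Fin n) (Fin n) F) : rotation Z 0 = 1 := by
  simp [rotation]

theorem hasDerivAt_rotation (Z : Matrix (Fin n) (Fin n) F) : HasDerivAt (rotation Z) Z 0 := by
  have h1 := (Real.hasDerivAt_sin 0).smul_const Z
  have h2 := ((Real.hasDerivAt_cos 0).const_sub 1).smul_const (Z * Z)
  have h3 := ((hasDerivAt_const (0 : ℝ) (1 : Matrix (Fin n) (Fin n) F)).fun_add h1).fun_add h2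
  simp only [Real.cos_zero, Real.sin_zero, one_smul, neg_zero, zero_smul, zero_add, add_zero] at h3
  exact h3

variable (n F) in
/-- The identity component of the group of unitary matrices. -/
def unitaryComponent : Set (Matrix (Fin n) (Fin n) F) := connectedComponentIn (unitaries n F) 1

theorem unitaryComponent_subset : unitaryComponent n F ⊆ unitaries n F :=
  connectedComponentIn_subset _ _

theorem one_mem_unitaryComponent : (1 : Matrix (Fin n) (Fin n) F) ∈ unitaryComponent n F :=
  mem_connectedComponentIn one_mem_unitaries

theorem isPreconnected_unitaryComponent : IsPreconnected (unitaryComponent n F) :=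
  isPreconnected_connectedComponentIn

theorem isClosed_unitaries : IsClosed (unitaries n F) := by
  have := continuous_conjTranspose (n := n) (F := F)
  exact (isClosed_eq (continuous_id.mul this) continuous_const).inter
    (isClosed_eq (this.mul continuous_id) continuous_const)

/-- The closure of a connected set is connected and the unitaries are closed, so the component is
closed; it is bounded since `‖U‖ ^ 2 = Re tr (U Uᴴ) = n`. Compactness provides the maximum behind
the spectral theorem. -/
theorem isCompact_unitaryComponent [FiniteDimensional ℝ F] :
    IsCompact (unitaryComponent n F) := by
  have hc : IsClosed (unitaryComponent n F) := by
    rw [← closure_subset_iff_isClosed]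
    exact isPreconnected_unitaryComponent.closure.subset_connectedComponentIn
      (subset_closure one_mem_unitaryComponent)
      (isClosed_unitaries.closure_subset_iff.2 unitaryComponent_subset)
  have : ProperSpace (Matrix (Fin n) (Fin n) F) := FiniteDimensional.proper_real _
  refine Metric.isCompact_of_isClosed_isBounded hc ?_
  refine (Metric.isBounded_closedBall (x := 0) (r := √n)).subset fun U hU => ?_
  rw [mem_closedBall_zero_iff]
  refine Real.le_sqrt_of_sq_le (le_of_eq ?_)
  rw [← real_inner_self_eq_norm_sq, inner_eq_reTrace, (unitaryComponent_subset hU).1, ← rdiag_one,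
    reTrace_rdiag]
  simp

/-- The path `t ↦ rotation Z t * U` starts at `U` and stays in the unitaries. -/
theorem rotation_mul_mem {Z : Matrix (Fin n) (Fin n) F} (hZ : Zᴴ = -Z) (hZ3 : Z * Z * Z = -Z)
    (θ : ℝ) {U : Matrix (Fin n) (Fin n) F} (hU : U ∈ unitaryComponent n F) :
    rotation Z θ * U ∈ unitaryComponent n F := by
  have h1 : IsPreconnected ((fun t => rotation Z t * U) '' Set.univ) :=
    isPreconnected_univ.image _ ((continuous_rotation Z).mul continuous_const).continuousOn
  have h2 := h1.subset_connectedComponentIn (x := U) (F := unitaries n F)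
    ⟨0, trivial, by simp [rotation_zero]⟩ (by
      rintro _ ⟨t, -, rfl⟩
      exact mul_mem_unitaries (rotation_mem_unitaries hZ hZ3 t) (unitaryComponent_subset hU))
  rw [← connectedComponentIn_eq hU] at h2
  exact h2 ⟨θ, trivial, rfl⟩

/-- The generator of the rotations in the plane of the `i`-th and `j`-th coordinates. -/
def planeGenerator (i j : Fin n) (u : F) : Matrix (Fin n) (Fin n) F :=
  Matrix.single i j u - Matrix.single j i (star u)

theorem planeGenerator_conjTranspose (i j : Fin n) (u : F) :
    (planeGenerator i j u)ᴴ = -planeGenerator i j u := by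
  simp [planeGenerator, Matrix.conjTranspose_single]

theorem planeGenerator_sq {i j : Fin n} (hij : i ≠ j) {u : F} (hu : u * star u = 1)
    (hu' : star u * u = 1) : planeGenerator i j u * planeGenerator i j u =
      -(Matrix.single i i 1 + Matrix.single j j 1) := by
  simp [planeGenerator, sub_mul, mul_sub, hij, hij.symm, hu, hu']
  abel

theorem planeGenerator_cube {i j : Fin n} (hij : i ≠ j) {u : F} (hu : u * star u = 1)
    (hu' : star u * u = 1) : planeGenerator i j u * planeGenerator i j u * planeGenerator i j u =
      -planeGenerator i j u := by
  rw [planeGenerator_sq hij hu hu']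
  simp [planeGenerator, add_mul, mul_sub, hij, hij.symm]
  abel

theorem reTrace_mul_single (C : Matrix (Fin n) (Fin n) F) (i j : Fin n) (u : F) :
    reTrace n F (C * Matrix.single i j u) = inner ℝ 1 (C j i * u) := by
  rw [reTrace_apply, Finset.sum_eq_single j]
  · simp
  · intro k _ hk
    simp [hk]
  · simp

/-- At a maximum, the derivative `Re tr ((A D - D A) Z)` in the direction of each rotation vanishes,
where `D = rdiag d`. For the rotation of the `i`-th and `j`-th coordinates whose phase `u` makes `A
j i * u = ‖A j i‖`, it equals `2 (d i - d j) ‖A j i‖`. -/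
theorem apply_eq_zero_of_isMax [FiniteDimensional ℝ F] {d : Fin n → ℝ}
    {A : Matrix (Fin n) (Fin n) F} (hA : Aᴴ = A)
    (hmax : ∀ Z : Matrix (Fin n) (Fin n) F, Zᴴ = -Z → Z * Z * Z = -Z → ∀ θ,
      reTrace n F (rdiag d * (rotation Z θ * A * (rotation Z θ)ᴴ)) ≤ reTrace n F (rdiag d * A))
    {i j : Fin n} (hij : d i ≠ d j) : A j i = 0 := by
  by_contra hne
  have hnorm : ‖A j i‖ ≠ 0 := norm_ne_zero_iff.2 hne
  set u : F := ‖A j i‖⁻¹ • star (A j i) with hu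
  have hu1 : u * star u = 1 := by
    rw [mul_star_self, hu, norm_smul, norm_star_eq, norm_inv, norm_norm, inv_mul_cancel₀ hnorm]
    simp
  have hu2 : star u * u = 1 := by
    nth_rewrite 2 [← star_star u]
    rw [mul_star_self, norm_star_eq, hu, norm_smul, norm_star_eq, norm_inv, norm_norm,
      inv_mul_cancel₀ hnorm]
    simp
  have hij' : i ≠ j := fun h => hij (by rw [h])
  set Z := planeGenerator i j u with hZ
  have hZ1 : Zᴴ = -Z := planeGenerator_conjTranspose i j u
  have hZ3 : Z * Z * Z = -Z := planeGenerator_cube hij' hu1 hu2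
  let L : Matrix (Fin n) (Fin n) F →L[ℝ] ℝ := (reTrace n F).toContinuousLinearMap
  have hd1 : HasDerivAt (fun θ => rotation Z (-θ)) (-Z) 0 := by
    have h := hasDerivAt_rotation Z
    rw [← neg_zero] at h
    have h' := h.scomp 0 (hasDerivAt_neg (0 : ℝ))
    rw [neg_smul, one_smul] at h'
    exact h'
  have hd2 := L.hasFDerivAt.comp_hasDerivAt (0 : ℝ)
    ((((hasDerivAt_rotation Z).mul_const A).mul hd1).const_mul (rdiag d))
  have hloc : IsLocalMax
      (L ∘ fun θ => rdiag d * (rotation Z θ * A * rotation Z (-θ))) 0 := by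
    refine Filter.Eventually.of_forall fun θ => ?_
    have := hmax Z hZ1 hZ3 θ
    rw [rotation_conjTranspose hZ1] at this
    simpa [rotation_zero, L] using this
  have h0 := hloc.hasDerivAt_eq_zero hd2
  have h1 : reTrace n F ((A * rdiag d - rdiag d * A) * Z) = 0 := by
    rw [← h0]
    simp only [neg_zero, rotation_zero, L, LinearMap.coe_toContinuousLinearMap', mul_add, mul_one,
      one_mul, map_add, sub_mul, map_sub, mul_neg, map_neg]
    rw [← Matrix.mul_assoc _ Z A, reTrace_mul_comm (rdiag d * Z) A, Matrix.mul_assoc A,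
      Matrix.mul_assoc _ A Z]
    abel
  have hC : ∀ k l, (A * rdiag d - rdiag d * A : Matrix (Fin n) (Fin n) F) k l =
      (d l - d k) • A k l := by
    intro k l
    simp [rdiag, sub_smul]
  have hsymm : A i j = star (A j i) := by
    conv_lhs => rw [← hA]
    rfl
  have hre : inner ℝ (1 : F) (A j i * u) = ‖A j i‖ := by
    rw [hu, mul_smul_comm, mul_star_self, inner_smul_right, inner_smul_right, re_one]
    field_simp
  have hre' : inner ℝ (1 : F) (A i j * star u) = ‖A j i‖ := by
    rw [hsymm, ← star_mul, re_star, HermitianAlgebra.re_mul_comm, hre]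
  rw [hZ, planeGenerator, mul_sub, map_sub, reTrace_mul_single, reTrace_mul_single, hC, hC,
    smul_mul_assoc, smul_mul_assoc, inner_smul_right, inner_smul_right, hre, hre'] at h1
  have : 2 * (d i - d j) * ‖A j i‖ = 0 := by linear_combination h1
  simp [sub_eq_zero, hij, hnorm] at this

theorem reTrace_rdiag_mul_conj (d a : Fin n → ℝ) (R : Matrix (Fin n) (Fin n) F) :
    reTrace n F (rdiag d * (R * rdiag a * Rᴴ)) = ∑ i, ∑ j, d i * a j * ‖R i j‖ ^ 2 := by
  rw [reTrace_apply]
  refine Finset.sum_congr rfl fun i _ => ?_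
  rw [rdiag, rdiag, Matrix.diagonal_mul, smul_mul_assoc, one_mul, inner_smul_right,
    Matrix.mul_apply, inner_sum, Finset.mul_sum]
  refine Finset.sum_congr rfl fun j _ => ?_
  rw [Matrix.mul_diagonal, Matrix.conjTranspose_apply, mul_smul_comm, mul_one, smul_mul_assoc,
    mul_star_self, inner_smul_right, inner_smul_right, re_one]
  ring

/-- The quarter turn is a transposition matrix up to signs, which squared norms ignore. Unlike the
transposition matrix, it is certain to stay in the identity component. -/
theorem rotation_pi_div_two_apply {i j : Fin n} (hij : i ≠ j) (k l : Fin n) :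
    ‖rotation (planeGenerator i j (1 : F)) (Real.pi / 2) k l‖ ^ 2 =
      if l = Equiv.swap i j k then 1 else 0 := by
  have h1 : ‖(1 : F)‖ = 1 := HermitianAlgebra.norm_one
  rw [rotation, planeGenerator_sq hij (by simp) (by simp)]
  simp only [planeGenerator, Real.sin_pi_div_two, Real.cos_pi_div_two, star_one, one_smul, sub_zero,
    Matrix.add_apply, Matrix.sub_apply, Matrix.neg_apply, Matrix.single_apply, Matrix.one_apply,
    Equiv.swap_apply_def]
  rcases eq_or_ne k i with rfl | hki
  · by_cases hl : l = j
    · subst hl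
      simp [hij, hij.symm, h1]
    · by_cases hl' : l = k
      · subst hl'
        simp [hij, hij.symm]
      · simp [hij.symm, hl, Ne.symm hl, Ne.symm hl']
  · rcases eq_or_ne k j with rfl | hkj
    · by_cases hl : l = i
      · subst hl
        simp [hij, hij.symm, h1]
      · by_cases hl' : l = k
        · subst hl'
          simp [hij, hij.symm]
        · simp [hij, hij.symm, hl, Ne.symm hl, Ne.symm hl']
    · by_cases hl : l = k
      · subst hl
        simp [hki, hkj, hki.symm, hkj.symm, h1]
      · simp [hki, hkj, hki.symm, hkj.symm, hl, Ne.symm hl]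

/-- The spectral theorem: Hermitian matrices over `F` are diagonalized, with real eigenvalues in
decreasing order, by unitary matrices in the identity component. -/
theorem exists_diagonalization [FiniteDimensional ℝ F] {A : Matrix (Fin n) (Fin n) F}
    (hA : Aᴴ = A) : ∃ U ∈ unitaryComponent n F, ∃ a : Fin n → ℝ, Antitone a ∧
      A = Uᴴ * rdiag a * U := by
  -- Strictly decreasing weights serve twice in maximizing `Re tr (rdiag d * (U A Uᴴ))`: being
  -- distinct, they force the maximizer to diagonalize `A`; being decreasing, they force the
  -- eigenvalues to decrease.
  let d : Fin n → ℝ := fun i => -(i : ℝ)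
  have hd : ∀ i j : Fin n, i < j → d j < d i := fun i j h => by
    simpa [d] using h
  have hct := continuous_conjTranspose (n := n) (F := F)
  have hre : Continuous (reTrace n F) := (reTrace n F).continuous_of_finiteDimensional
  obtain ⟨U, hU, hmax⟩ := isCompact_unitaryComponent.exists_isMaxOn
    ⟨1, one_mem_unitaryComponent (n := n) (F := F)⟩
    (f := fun U => reTrace n F (rdiag d * (U * A * Uᴴ))) (by fun_prop)
  have hUU := unitaryComponent_subset hU
  set A' := U * A * Uᴴ with hA'
  have hA'H : A'ᴴ = A' := by simp [hA', hA, Matrix.mul_assoc]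
  have hmax' : ∀ Z : Matrix (Fin n) (Fin n) F, Zᴴ = -Z → Z * Z * Z = -Z → ∀ θ,
      reTrace n F (rdiag d * (rotation Z θ * A' * (rotation Z θ)ᴴ)) ≤
        reTrace n F (rdiag d * A') := by
    intro Z hZ hZ3 θ
    have h := hmax (rotation_mul_mem hZ hZ3 θ hU)
    simp only [Set.mem_ofPred_eq, conjTranspose_mul] at h
    simpa only [hA', Matrix.mul_assoc] using h
  have hdne : ∀ i j : Fin n, i ≠ j → d i ≠ d j := fun i j h => by
    rcases h.lt_or_gt with h | h
    · exact (hd i j h).ne'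
    · exact (hd j i h).ne
  have hdiag : A' = rdiag fun i => inner ℝ (1 : F) (A' i i) := by
    ext i j
    by_cases h : i = j
    · subst h
      simp only [rdiag, Matrix.diagonal_apply_eq]
      exact HermitianAlgebra.eq_re_smul_one _ (congrFun (congrFun hA'H i) i)
    · rw [apply_eq_zero_of_isMax hA'H hmax' (hdne j i (Ne.symm h))]
      simp [rdiag, h]
  set a : Fin n → ℝ := fun i => inner ℝ (1 : F) (A' i i) with ha
  refine ⟨U, hU, a, fun i j hij => ?_, ?_⟩
  · rcases hij.eq_or_lt with rfl | hlt
    · exact le_rfl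
    have hne := hlt.ne
    -- The quarter turn exchanges the `i`-th and `j`-th eigenvalues, so maximality reads `0 ≤ (d i -
    -- d j) * (a i - a j)`.
    have h := hmax' (planeGenerator i j 1) (planeGenerator_conjTranspose i j 1)
      (planeGenerator_cube hne (by simp) (by simp)) (Real.pi / 2)
    rw [hdiag, reTrace_rdiag_mul_conj, ← rdiag_mul, reTrace_rdiag] at h
    simp only [rotation_pi_div_two_apply hne, mul_ite, mul_one, mul_zero, Finset.sum_ite_eq',
      Finset.mem_univ, if_true, Pi.mul_apply] at h
    rw [← sub_nonneg, ← Finset.sum_sub_distrib, Fintype.sum_eq_add i j hne] at h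
    · simp only [Equiv.swap_apply_left, Equiv.swap_apply_right] at h
      have h' : 0 ≤ (d i - d j) * (a i - a j) := by linarith
      exact sub_nonneg.1 (nonneg_of_mul_nonneg_right h' (sub_pos.2 (hd i j hlt)))
    · rintro k ⟨hki, hkj⟩
      rw [Equiv.swap_apply_of_ne_of_ne hki hkj, sub_self]
  · rw [← hdiag, hA']
    simp only [← Matrix.mul_assoc, hUU.2, Matrix.one_mul]
    rw [Matrix.mul_assoc, hUU.2, Matrix.mul_one]

end HermitianSphere

/-! ### Regular zero sets of homogeneous systems on the unit sphere. -/

namespace EuclideanSubmanifold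

variable {V : Type*} [NormedAddCommGroup V] [InnerProductSpace ℝ V]

/-- Finitely many linear functionals on an inner product space are jointly surjective if and only
if their gradients are linearly independent. -/
theorem surjective_inner_iff {k : ℕ} (L : V →ₗ[ℝ] Fin k → ℝ) (b : Fin k → V) (c : Fin k → ℝ)
    (hc : ∀ j, c j ≠ 0)
    (hL : ∀ X j, L X j = c j * inner ℝ (b j) X) :
    Function.Surjective L ↔ LinearIndependent ℝ b := by
  rw [Fintype.linearIndependent_iff]
  refine ⟨fun h g hg => ?_, fun h => ?_⟩
  · obtain ⟨X, hX⟩ := h fun j => c j * g j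
    have h1 : ∀ j, inner ℝ (b j) X = g j := fun j => by
      have := congrFun hX j
      rw [hL] at this
      exact mul_left_cancel₀ (hc j) this
    have h2 : ∑ j, g j * g j = 0 := by
      calc ∑ j, g j * g j = inner ℝ (∑ j, g j • b j) X := by
            simp [sum_inner, inner_smul_left, h1]
        _ = 0 := by rw [hg, inner_zero_left]
    intro j
    have := (Finset.sum_eq_zero_iff_of_nonneg fun i _ => mul_self_nonneg (g i)).1 h2 j
      (Finset.mem_univ j)
    exact mul_self_eq_zero.1 this
  · rw [← LinearMap.range_eq_top]
    by_contra hne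
    -- A nonzero functional killing the range is, up to the factors `c j`, a linear relation between
    -- the `b j`.
    obtain ⟨φ, hφ, hle⟩ := Submodule.exists_le_ker_of_lt_top _ (lt_top_iff_ne_top.2 hne)
    refine hφ (LinearMap.pi_ext' fun j => LinearMap.ext_ring ?_)
    have hφL : ∀ X, φ (L X) = ∑ j, φ (Pi.single j 1) * L X j := by
      intro X
      conv_lhs => rw [LinearMap.pi_apply_eq_sum_univ φ (L X)]
      refine Finset.sum_congr rfl fun j _ => ?_
      rw [smul_eq_mul, mul_comm]
      congr 2
      ext i
      simp [Pi.single_apply, eq_comm]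
    have h1 : ∑ j, (φ (Pi.single j 1) * c j) • b j = 0 := by
      refine ext_inner_right ℝ fun X => ?_
      rw [inner_zero_left, sum_inner, ← (hle ⟨X, rfl⟩ : φ (L X) = 0), hφL]
      refine Finset.sum_congr rfl fun j _ => ?_
      rw [inner_smul_left, hL]
      simp [mul_assoc]
    simpa [hc j] using h _ h1 j

section Sphere

theorem hasFDerivAt_norm_sq_fin_one (x : V) : HasFDerivAt (fun (A : V) (_ : Fin 1) => ‖A‖ ^ 2)
    (ContinuousLinearMap.pi fun _ : Fin 1 => 2 • innerSL ℝ x) x :=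
  hasFDerivAt_pi.2 fun _ => (hasStrictFDerivAt_norm_sq x).hasFDerivAt

variable [FiniteDimensional ℝ V]

theorem isRegularLevelSet_sphere :
    IsRegularLevelSet (Metric.sphere (0 : V) 1) Set.univ fun (A : V) (_ : Fin 1) => ‖A‖ ^ 2 where
  isOpen := isOpen_univ
  contDiff := contDiff_pi.2 fun _ => contDiff_norm_sq ℝ
  mem_iff x hx y := by
    rw [mem_sphere_zero_iff_norm] at *
    have h3 : ‖y‖ ^ 2 = 1 ↔ ‖y‖ = 1 := pow_eq_one_iff_of_nonneg (norm_nonneg y) two_ne_zero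
    simp [hx, funext_iff, h3]
  surjective x hx := by
    rw [(hasFDerivAt_norm_sq_fin_one x).fderiv]
    refine (surjective_inner_iff _ (fun _ => x) (fun _ => 2) (by simp) ?_).2 ?_
    · intro X j
      simp
    · rw [linearIndependent_unique_iff]
      intro h0
      rw [mem_sphere_zero_iff_norm] at hx
      simp [h0] at hx

theorem mem_tangentSpace_sphere {A : V} (hA : A ∈ Metric.sphere (0 : V) 1) {X : V} :
    X ∈ tangentSpace (Metric.sphere (0 : V) 1) A ↔ inner ℝ A X = 0 := by
  rw [isRegularLevelSet_sphere.tangentSpace_eq hA, (hasFDerivAt_norm_sq_fin_one A).fderiv]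
  change (ContinuousLinearMap.pi fun _ : Fin 1 => 2 • innerSL ℝ A) X = 0 ↔ _
  simp [funext_iff]

end Sphere

/-- A smooth map `Ψ` whose components have gradients `c j • w j`, where `Ψ A j = ⟪w j A, A⟫` as for
homogeneous functions. -/
structure HomogeneousSystem {p : ℕ} (Ψ : V → Fin p → ℝ) (w : Fin p → V → V) (c : Fin p → ℝ) :
    Prop where
  contDiff : ContDiff ℝ ∞ Ψ
  contDiff_gradient : ∀ j, ContDiff ℝ ∞ (w j)
  ne_zero : ∀ j, c j ≠ 0
  fderiv_apply : ∀ A X j, fderiv ℝ Ψ A X j = c j * inner ℝ (w j A) X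
  inner_self : ∀ A j, inner ℝ (w j A) A = Ψ A j

/-- The regular points in the zero level set of the restriction of `Ψ` to the unit sphere. -/
def regularSet {p : ℕ} (Ψ : V → Fin p → ℝ) : Set V :=
  {A | A ∈ Metric.sphere (0 : V) 1 ∧ Ψ A = 0 ∧ IsRegularPoint (Metric.sphere (0 : V) 1) Ψ A}

namespace HomogeneousSystem

variable {p : ℕ} {Ψ : V → Fin p → ℝ} {w : Fin p → V → V} {c : Fin p → ℝ}

/-- The defining equations of the regular set. -/
def defining (Ψ : V → Fin p → ℝ) (A : V) : Fin (p + 1) → ℝ := Fin.cons (‖A‖ ^ 2) (Ψ A)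

/-- The normal frame of the regular set in `V`. -/
def frame (w : Fin p → V → V) (i : Fin (p + 1)) (A : V) : V :=
  (Fin.cons A (fun j => w j A) : Fin (p + 1) → V) i

theorem contDiff_defining (h : HomogeneousSystem Ψ w c) : ContDiff ℝ ∞ (defining Ψ) := by
  refine contDiff_pi.2 (Fin.cases ?_ fun j => ?_)
  · exact contDiff_norm_sq ℝ
  · exact contDiff_pi.1 h.contDiff j

theorem contDiff_frame (h : HomogeneousSystem Ψ w c) (i : Fin (p + 1)) :
    ContDiff ℝ ∞ (frame w i) := by
  refine Fin.cases ?_ (fun j => ?_) i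
  · exact contDiff_id
  · exact h.contDiff_gradient j

theorem fderiv_defining_apply (h : HomogeneousSystem Ψ w c) (A X : V) (i : Fin (p + 1)) :
    fderiv ℝ (defining Ψ) A X i =
      (Fin.cons 2 c : Fin (p + 1) → ℝ) i * inner ℝ (frame w i A) X := by
  have h1 : ∀ {q : ℕ} {g : V → Fin q → ℝ}, ContDiff ℝ ∞ g → ∀ i : Fin q,
      fderiv ℝ g A X i = fderiv ℝ (fun A => g A i) A X := fun {q g} hg i => by
    rw [(hasFDerivAt_pi'.1 (hg.differentiable (by simp) A).hasFDerivAt i).fderiv]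
    rfl
  rw [h1 h.contDiff_defining]
  refine Fin.cases ?_ (fun j => ?_) i
  · change fderiv ℝ (fun A : V => ‖A‖ ^ 2) A X = _
    rw [(hasStrictFDerivAt_norm_sq A).hasFDerivAt.fderiv]
    simp [frame]
  · change fderiv ℝ (fun A => Ψ A j) A X = _
    rw [← h1 h.contDiff, h.fderiv_apply]
    simp [frame]

theorem cons_two_ne_zero (h : HomogeneousSystem Ψ w c) (i : Fin (p + 1)) :
    (Fin.cons 2 c : Fin (p + 1) → ℝ) i ≠ 0 := by
  refine Fin.cases ?_ (fun j => ?_) i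
  · simp
  · simpa using h.ne_zero j

variable [FiniteDimensional ℝ V]

/-- Euler's relation `⟪w j A, A⟫ = Ψ A j`: on the zero set the gradients are already tangent to the
sphere. -/
theorem gradient_mem_tangentSpace_sphere (h : HomogeneousSystem Ψ w c) {A : V}
    (hAS : A ∈ Metric.sphere (0 : V) 1) (hA : Ψ A = 0) (j : Fin p) :
    w j A ∈ tangentSpace (Metric.sphere (0 : V) 1) A := by
  rw [mem_tangentSpace_sphere hAS, real_inner_comm, h.inner_self, hA, Pi.zero_apply]

/-- As the gradients are tangent to the sphere, they represent the restricted differential without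
any projection, and their independence may be tested in `V`. -/
theorem mem_regularSet_iff (h : HomogeneousSystem Ψ w c) {A : V} :
    A ∈ regularSet Ψ ↔ ‖A‖ = 1 ∧ Ψ A = 0 ∧ LinearIndependent ℝ fun j => w j A := by
  rw [← mem_sphere_zero_iff_norm]
  refine and_congr_right fun hAS => and_congr_right fun hA => ?_
  have hd : HasFDerivWithinAt Ψ (fderiv ℝ Ψ A) (Metric.sphere (0 : V) 1) A :=
    (h.contDiff.differentiable (by simp) A).hasFDerivAt.hasFDerivWithinAt
  let b : Fin p → tangentSpace (Metric.sphere (0 : V) 1) A :=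
    fun j => ⟨w j A, h.gradient_mem_tangentSpace_sphere hAS hA j⟩
  have h1 := surjective_inner_iff (differential (Metric.sphere (0 : V) 1) Ψ A).toLinearMap b c
    h.ne_zero (fun X j => by
      rw [ContinuousLinearMap.coe_coe, differential_apply hd, h.fderiv_apply]
      rfl)
  refine h1.trans ?_
  rw [← LinearMap.linearIndependent_iff (tangentSpace (Metric.sphere (0 : V) 1) A).subtype
    (Submodule.ker_subtype _)]
  rfl

/-- By Euler's relation the position vector `A` is orthogonal to all `w j A`, so adjoining it keeps
independence. -/
theorem linearIndependent_frame (h : HomogeneousSystem Ψ w c) {A : V} (hA : A ∈ regularSet Ψ) :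
    LinearIndependent ℝ fun i => frame w i A := by
  obtain ⟨h1, h2, h3⟩ := h.mem_regularSet_iff.1 hA
  rw [Fintype.linearIndependent_iff] at h3 ⊢
  intro g hg
  rw [Fin.sum_univ_succ] at hg
  simp only [frame, Fin.cons_zero, Fin.cons_succ] at hg
  have h4 := congrArg (fun X => inner ℝ X A) hg
  simp only [inner_add_left, sum_inner, inner_smul_left, h.inner_self, h2, Pi.zero_apply, mul_zero,
    Finset.sum_const_zero, add_zero, inner_zero_left, real_inner_self_eq_norm_sq, h1, one_pow,
    mul_one] at h4
  have h0 : g 0 = 0 := h4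
  rw [h0, zero_smul, zero_add] at hg
  exact Fin.cases h0 (h3 _ hg)

/-- Regularity has become the open condition that the `w j A` are independent; inside that open set
only the equations `‖A‖ ^ 2 = 1` and `Ψ A = 0` remain. -/
theorem isRegularLevelSet (h : HomogeneousSystem Ψ w c) :
    IsRegularLevelSet (regularSet Ψ) {A | LinearIndependent ℝ fun j => w j A} (defining Ψ) where
  isOpen := by
    have hc : Continuous fun (A : V) j => w j A :=
      continuous_pi fun j => (h.contDiff_gradient j).continuous
    exact (isOpen_setOfPred_linearIndependent (𝕜 := ℝ)).preimage hc
  contDiff := h.contDiff_defining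
  mem_iff x hx y := by
    obtain ⟨h1, h2, -⟩ := h.mem_regularSet_iff.1 hx
    have h3 : ‖y‖ ^ 2 = 1 ↔ ‖y‖ = 1 := pow_eq_one_iff_of_nonneg (norm_nonneg y) two_ne_zero
    rw [h.mem_regularSet_iff, Set.mem_ofPred_eq, defining, defining, Fin.cons_inj, h1, h2, one_pow,
      h3]
    tauto
  surjective x hx :=
    (surjective_inner_iff _ _ _ h.cons_two_ne_zero (h.fderiv_defining_apply x)).2
      (h.linearIndependent_frame hx)

theorem tangentSpace_eq (h : HomogeneousSystem Ψ w c) {A : V} (hA : A ∈ regularSet Ψ) :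
    tangentSpace (regularSet Ψ) A = (Submodule.span ℝ (Set.range fun i => frame w i A))ᗮ := by
  rw [h.isRegularLevelSet.tangentSpace_eq hA]
  ext X
  rw [Submodule.mem_orthogonal]
  change fderiv ℝ (defining Ψ) A X = 0 ↔ _
  have h1 : fderiv ℝ (defining Ψ) A X = 0 ↔ ∀ i, inner ℝ (frame w i A) X = 0 := by
    rw [funext_iff]
    refine forall_congr' fun i => ?_
    rw [h.fderiv_defining_apply, Pi.zero_apply, mul_eq_zero,
      or_iff_right (h.cons_two_ne_zero i)]
  rw [h1]
  refine ⟨fun hX u hu => ?_, fun hX i => hX _ (Submodule.subset_span ⟨i, rfl⟩)⟩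
  induction hu using Submodule.span_induction with
  | mem u hu =>
    obtain ⟨i, rfl⟩ := hu
    exact hX i
  | zero => exact inner_zero_left _
  | add u v _ _ hu hv => rw [inner_add_left, hu, hv, add_zero]
  | smul r u _ hu => rw [inner_smul_left, hu, mul_zero]

/-- The normal space in `V` is the span of the frame; tangency to the sphere removes the component
along `A`. -/
theorem mem_normalSpace_iff (h : HomogeneousSystem Ψ w c) {A : V} (hA : A ∈ regularSet Ψ) {v : V} :
    v ∈ normalSpace (Metric.sphere (0 : V) 1) (regularSet Ψ) A ↔
      ∃ g : Fin p → ℝ, v = ∑ j, g j • w j A := by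
  obtain ⟨h1, h2, h3⟩ := h.mem_regularSet_iff.1 hA
  have hAS : A ∈ Metric.sphere (0 : V) 1 := hA.1
  rw [normalSpace, Submodule.mem_inf, h.tangentSpace_eq hA, Submodule.orthogonal_orthogonal]
  constructor
  · rintro ⟨hv1, hv2⟩
    obtain ⟨g, rfl⟩ := (Submodule.mem_span_range_iff_exists_fun ℝ).1 hv2
    rw [mem_tangentSpace_sphere hAS, Fin.sum_univ_succ, real_inner_comm] at hv1
    simp only [frame, Fin.cons_zero, Fin.cons_succ, inner_add_left, sum_inner,
      inner_smul_left, h.inner_self, h2, Pi.zero_apply, mul_zero,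
      Finset.sum_const_zero, add_zero, real_inner_self_eq_norm_sq, h1, one_pow, mul_one] at hv1
    have h0 : g 0 = 0 := hv1
    refine ⟨fun j => g j.succ, ?_⟩
    rw [Fin.sum_univ_succ, h0, zero_smul, zero_add]
    rfl
  · rintro ⟨g, rfl⟩
    refine ⟨Submodule.sum_mem _ fun j _ => Submodule.smul_mem _ _
      (h.gradient_mem_tangentSpace_sphere hAS h2 j), Submodule.sum_mem _ fun j _ =>
      Submodule.smul_mem _ _ (Submodule.subset_span ⟨j.succ, rfl⟩)⟩

theorem isSubmanifold (h : HomogeneousSystem Ψ w c) {d : ℕ}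
    (hd : d + (p + 1) = Module.finrank ℝ V) : IsSubmanifold (regularSet Ψ) d :=
  h.isRegularLevelSet.isSubmanifold hd

theorem isOrientable (h : HomogeneousSystem Ψ w c) {d : ℕ}
    (hd : d + (p + 1) = Module.finrank ℝ V) : IsOrientable (regularSet Ψ) d :=
  isOrientable_of_normalFrame hd (frame w) (fun i => (h.contDiff_frame i).contDiffOn)
    (fun _ hx => h.linearIndependent_frame hx) fun _ hx => h.tangentSpace_eq hx

/-- Austerity follows if each point is fixed by an isometric involution that preserves the regular
set and reverses the normal frame. -/
theorem isAustere (h : HomogeneousSystem Ψ w c)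
    (hσ : ∀ x ∈ regularSet Ψ, ∃ σ : V →L[ℝ] V, (∀ y ∈ regularSet Ψ, σ y ∈ regularSet Ψ) ∧
      (∀ y, σ (σ y) = y) ∧ (∀ y z, inner ℝ (σ y) z = inner ℝ y (σ z)) ∧ σ x = x ∧
      ∀ j, σ (w j x) = -w j x) :
    IsAustere (Metric.sphere (0 : V) 1) (regularSet Ψ) := by
  intro U ξ hU hξ x hx c
  obtain ⟨σ, h1, h2, h3, h4, h5⟩ := hσ x hx.1
  refine h.isRegularLevelSet.finrank_eigenspace_shapeOperator_neg hx.1 σ h1 h2 h3 h4 hU hx.2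
    hξ.smooth (fun y hy => (hξ.normal y hy).2) ?_ c
  obtain ⟨g, hg⟩ := (h.mem_normalSpace_iff hx.1).1 (hξ.normal x hx)
  rw [hg, map_sum, ← Finset.sum_neg_distrib]
  exact Finset.sum_congr rfl fun j _ => by rw [map_smul, h5, smul_neg]

end HomogeneousSystem

/-- A normal field is parallel at `x` if its derivatives along curves are orthogonal to the normal
space. -/
theorem normalDerivative_eq_zero [FiniteDimensional ℝ V] {N M : Set V} {ξ : V → V} {x : V}
    (hξ : DifferentiableWithinAt ℝ ξ M x)
    (h : ∀ X γ, IsCurveThrough M x X γ → ∀ D, HasDerivAt (ξ ∘ γ) D 0 →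
      ∀ v ∈ normalSpace N M x, inner ℝ D v = 0) : normalDerivative N M ξ x = 0 := by
  obtain ⟨ξ', hξ'⟩ := hξ
  have hle : ∀ v ∈ normalSpace N M x, tangentSpace M x ≤ (innerSL ℝ v ∘L ξ').ker := fun v hv =>
    tangentSpace_le_iff.2 fun X γ hγ => by
      have := h X γ hγ _ (hγ.comp_hasDerivAt hξ') v hv
      rw [real_inner_comm] at this
      exact this
  ext1 X
  refine ext_inner_right ℝ fun v => ?_
  rw [normalDerivative, ContinuousLinearMap.comp_apply, differential_apply hξ',
    Submodule.inner_orthogonalProjectionOnto_eq_of_mem_right, zero_apply, inner_zero_left,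
    real_inner_comm]
  exact hle v v.2 X.2

end EuclideanSubmanifold

/-! ### Gradients of the functions `tr A ^ k`. -/

namespace HermitianSphere

open EuclideanSubmanifold Filter Topology Matrix

variable {n : ℕ} {F : Type*} [NormedRing F] [InnerProductSpace ℝ F]

attribute [local instance] matrixTopology matrixT2Space

variable [StarRing F] [StarModule ℝ F] [HermitianAlgebra F]

theorem reTrace_eq_zero (X : E n F) : reTrace n F (X : Matrix (Fin n) (Fin n) F) = 0 := by
  have h : Matrix.trace (X : Matrix (Fin n) (Fin n) F) = 0 := X.2.2
  simp [reTrace, h]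

theorem coe_conjTranspose (X : E n F) :
    (X : Matrix (Fin n) (Fin n) F)ᴴ = (X : Matrix (Fin n) (Fin n) F) := X.2.1

theorem pow_conjTranspose (X : E n F) (k : ℕ) :
    ((X : Matrix (Fin n) (Fin n) F) ^ k)ᴴ = (X : Matrix (Fin n) (Fin n) F) ^ k := by
  rw [Matrix.conjTranspose_pow, coe_conjTranspose]

theorem trace_eq_reTrace {A : Matrix (Fin n) (Fin n) F} (hA : Aᴴ = A) :
    Matrix.trace A = reTrace n F A • (1 : F) :=
  HermitianAlgebra.eq_re_smul_one _ (by rw [← Matrix.trace_conjTranspose, hA])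

theorem mem_E_iff {A : Matrix (Fin n) (Fin n) F} :
    A ∈ E n F ↔ Aᴴ = A ∧ reTrace n F A = 0 := by
  refine ⟨fun h => ⟨h.1, reTrace_eq_zero ⟨A, h⟩⟩, fun h => ⟨h.1, ?_⟩⟩
  rw [trace_eq_reTrace h.1, h.2, zero_smul]

theorem f_eq_reTrace (k : ℕ) (A : E n F) :
    f k A = reTrace n F ((A : Matrix (Fin n) (Fin n) F) ^ k) := rfl

variable [FiniteDimensional ℝ F]

variable (n F) in
/-- The orthogonal projection onto the traceless Hermitian matrices. -/
def projE : Matrix (Fin n) (Fin n) F →L[ℝ] E n F := (E n F).orthogonalProjectionOnto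

theorem inner_projE (A : Matrix (Fin n) (Fin n) F) (X : E n F) :
    inner ℝ (projE n F A) X = inner ℝ A (X : Matrix (Fin n) (Fin n) F) :=
  Submodule.inner_orthogonalProjectionOnto_eq_of_mem_right X A

theorem inner_projE_pow (A X : E n F) (k : ℕ) :
    inner ℝ (projE n F ((A : Matrix (Fin n) (Fin n) F) ^ k)) X =
      reTrace n F ((A : Matrix (Fin n) (Fin n) F) ^ k * X) := by
  rw [inner_projE, inner_eq_reTrace, coe_conjTranspose]

theorem reTrace_one : reTrace n F (1 : Matrix (Fin n) (Fin n) F) = n := by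
  rw [← rdiag_one, reTrace_rdiag]
  simp

/-- Multiples of `1` are orthogonal to `E n F`, and subtracting the right one makes a Hermitian
matrix traceless. -/
theorem coe_projE [NeZero n] {A : Matrix (Fin n) (Fin n) F} (hA : Aᴴ = A) :
    (projE n F A : Matrix (Fin n) (Fin n) F) = A - (reTrace n F A / n) • 1 := by
  have hmem : A - (reTrace n F A / n) • (1 : Matrix (Fin n) (Fin n) F) ∈ E n F := by
    rw [mem_E_iff]
    refine ⟨by simp [hA, Matrix.conjTranspose_smul], ?_⟩
    rw [map_sub, map_smul, reTrace_one, smul_eq_mul, div_mul_cancel₀ _ (NeZero.ne _), sub_self]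
  have h : projE n F A = ⟨_, hmem⟩ := by
    refine ext_inner_right ℝ fun X => ?_
    rw [inner_projE]
    change _ = inner ℝ (A - (reTrace n F A / n) • (1 : Matrix (Fin n) (Fin n) F))
      (X : Matrix (Fin n) (Fin n) F)
    rw [inner_sub_left, inner_smul_left, inner_eq_reTrace 1, coe_conjTranspose, Matrix.one_mul,
      reTrace_eq_zero, mul_zero, sub_zero]
  rw [h]

theorem projE_coe (X : E n F) : projE n F (X : Matrix (Fin n) (Fin n) F) = X :=
  (E n F).orthogonalProjectionOnto_mem_subspace_eq_self X

theorem projE_one [NeZero n] : projE n F (1 : Matrix (Fin n) (Fin n) F) = 0 := by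
  ext1
  rw [coe_projE (by simp), reTrace_one, div_self (NeZero.ne _)]
  simp

theorem contDiff_coe : ContDiff ℝ ∞ fun X : E n F => (X : Matrix (Fin n) (Fin n) F) :=
  (E n F).subtypeL.contDiff

section

attribute [local instance] matrixNormedRing matrixNormedAlgebra

theorem contDiff_coe_pow (k : ℕ) :
    ContDiff ℝ ∞ fun X : E n F => (X : Matrix (Fin n) (Fin n) F) ^ k := contDiff_coe.pow k

theorem hasFDerivAt_coe_pow (k : ℕ) (A : E n F) :
    HasFDerivAt (fun X : E n F => (X : Matrix (Fin n) (Fin n) F) ^ k)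
      (∑ i ∈ Finset.range k, MulOpposite.op ((A : Matrix (Fin n) (Fin n) F) ^ i) •
        (A : Matrix (Fin n) (Fin n) F) ^ (k.pred - i) • (E n F).subtypeL) A :=
  ((E n F).subtypeL.hasFDerivAt (x := A)).fun_pow' k

/-- The noncommutative power rule has `k` terms `A ^ (k-1-i) * X * A ^ i`; cyclicity of the real
trace makes them all equal. -/
theorem reTrace_sum_pow (k : ℕ) (A X : E n F) :
    reTrace n F (∑ i ∈ Finset.range k, (A : Matrix (Fin n) (Fin n) F) ^ (k.pred - i) * X *
      (A : Matrix (Fin n) (Fin n) F) ^ i) =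
      k * inner ℝ (projE n F ((A : Matrix (Fin n) (Fin n) F) ^ (k - 1))) X := by
  have h3 : ∀ i ∈ Finset.range k, reTrace n F ((A : Matrix (Fin n) (Fin n) F) ^ (k.pred - i) * X *
      (A : Matrix (Fin n) (Fin n) F) ^ i) =
      inner ℝ (projE n F ((A : Matrix (Fin n) (Fin n) F) ^ (k - 1))) X := by
    intro i hi
    rw [reTrace_mul_comm, ← Matrix.mul_assoc, ← pow_add, inner_projE_pow]
    congr 3
    have := Finset.mem_range.1 hi
    rw [Nat.pred_eq_sub_one]
    omega
  rw [map_sum, Finset.sum_congr rfl h3, Finset.sum_const, Finset.card_range, nsmul_eq_mul]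

theorem hasFDerivAt_f (k : ℕ) (A : E n F) :
    HasFDerivAt (f k) ((k : ℝ) • innerSL ℝ (projE n F ((A : Matrix (Fin n) (Fin n) F) ^ (k - 1))))
      A := by
  have h2 := (reTrace n F).toContinuousLinearMap.hasFDerivAt.comp A (hasFDerivAt_coe_pow k A)
  refine HasFDerivAt.congr_fderiv (f := f k) h2 (ContinuousLinearMap.ext fun X => ?_)
  rw [_root_.smul_apply, innerSL_apply_apply, smul_eq_mul, ← reTrace_sum_pow,
    ContinuousLinearMap.comp_apply, _root_.sum_apply]
  rfl

end

theorem contDiff_projE_pow (k : ℕ) :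
    ContDiff ℝ ∞ fun X : E n F => projE n F ((X : Matrix (Fin n) (Fin n) F) ^ k) :=
  (projE n F).contDiff.comp (contDiff_coe_pow k)

theorem contDiff_f (k : ℕ) : ContDiff ℝ ∞ (f k : E n F → ℝ) :=
  (reTrace n F).toContinuousLinearMap.contDiff.comp (contDiff_coe_pow k)

/-- The even powers of `A`, projected to traceless matrices. They span the normal space. -/
def evenNormal (j : Fin ((n - 1) / 2)) (A : E n F) : E n F :=
  projE n F ((A : Matrix (Fin n) (Fin n) F) ^ (2 * (j : ℕ) + 2))

theorem contDiff_Phi : ContDiff ℝ ∞ (Phi : E n F → Fin ((n - 1) / 2) → ℝ) :=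
  contDiff_pi.2 fun _ => contDiff_f _

theorem fderiv_Phi_apply (A X : E n F) (j : Fin ((n - 1) / 2)) :
    fderiv ℝ Phi A X j = (2 * (j : ℕ) + 3 : ℝ) * inner ℝ (evenNormal j A) X := by
  have h := (hasFDerivAt_pi.2 fun j : Fin ((n - 1) / 2) =>
    hasFDerivAt_f (2 * (j : ℕ) + 3) A).fderiv
  change fderiv ℝ Phi A = _ at h
  rw [h]
  simp [evenNormal]

theorem homogeneousSystem_Phi : HomogeneousSystem (Phi : E n F → Fin ((n - 1) / 2) → ℝ)
    evenNormal fun j => (2 * (j : ℕ) + 3 : ℝ) where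
  contDiff := contDiff_Phi
  contDiff_gradient _ := contDiff_projE_pow _
  ne_zero j := by positivity
  fderiv_apply := fderiv_Phi_apply
  inner_self A j := by
    rw [evenNormal, inner_projE_pow, ← pow_succ]
    rfl

end HermitianSphere

/-! ### Antisymmetric spectra, Newton's identities and Vandermonde determinants. -/

namespace HermitianSphere

open Filter Topology

/-- Newton's identities express `k e_k` by lower `e_i` and power sums; dividing by `k` gives the
induction. -/
theorem aeval_esymm_eq_of_sum_pow_eq {N : ℕ} {a b : Fin N → ℝ}
    (h : ∀ k, 1 ≤ k → k ≤ N → ∑ i, a i ^ k = ∑ i, b i ^ k) (k : ℕ) (hk : k ≤ N) :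
    MvPolynomial.aeval a (MvPolynomial.esymm (Fin N) ℝ k) =
      MvPolynomial.aeval b (MvPolynomial.esymm (Fin N) ℝ k) := by
  induction k using Nat.strong_induction_on with
  | _ k ih =>
    rcases Nat.eq_zero_or_pos k with rfl | hpos
    · simp
    have hnewton : ∀ x : Fin N → ℝ,
        (k : ℝ) * MvPolynomial.aeval x (MvPolynomial.esymm (Fin N) ℝ k) =
        (-1) ^ (k + 1) * ∑ c ∈ Finset.HasAntidiagonal.antidiagonal k with (c : ℕ × ℕ).1 < k,
          (-1) ^ c.1 * MvPolynomial.aeval x (MvPolynomial.esymm (Fin N) ℝ c.1) *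
            ∑ i, x i ^ c.2 := by
      intro x
      have := congrArg (MvPolynomial.aeval x) (MvPolynomial.mul_esymm_eq_sum (Fin N) ℝ k)
      simpa [MvPolynomial.psum] using this
    have hk0 : (k : ℝ) ≠ 0 := by exact_mod_cast hpos.ne'
    refine mul_left_cancel₀ hk0 ?_
    rw [hnewton, hnewton]
    congr 1
    refine Finset.sum_congr rfl fun c hc => ?_
    obtain ⟨hc1, hc2⟩ := Finset.mem_filter.1 hc
    rw [Finset.HasAntidiagonal.mem_antidiagonal] at hc1
    rw [ih c.1 hc2 (by omega), h c.2 (by omega) (by omega)]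

/-- Newton: a multiset of `N` real numbers is determined by its first `N` power sums. -/
theorem multiset_eq_of_sum_pow_eq {N : ℕ} {a b : Fin N → ℝ}
    (h : ∀ k, 1 ≤ k → k ≤ N → ∑ i, a i ^ k = ∑ i, b i ^ k) :
    Finset.univ.val.map a = Finset.univ.val.map b := by
  have hes : ∀ k ≤ N, (Finset.univ.val.map a).esymm k = (Finset.univ.val.map b).esymm k := by
    intro k hk
    have := aeval_esymm_eq_of_sum_pow_eq h k hk
    rwa [MvPolynomial.aeval_esymm_eq_multiset_esymm, MvPolynomial.aeval_esymm_eq_multiset_esymm]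
      at this
  have hp : ((Finset.univ.val.map a).map fun t => Polynomial.X - Polynomial.C t).prod =
      ((Finset.univ.val.map b).map fun t => Polynomial.X - Polynomial.C t).prod := by
    rw [Multiset.prod_X_sub_X_eq_sum_esymm, Multiset.prod_X_sub_X_eq_sum_esymm]
    simp only [Multiset.card_map]
    refine Finset.sum_congr rfl fun k hk => ?_
    rw [hes k (by simpa [Nat.lt_succ_iff] using hk)]
  rw [← Polynomial.roots_multiset_prod_X_sub_C (Finset.univ.val.map a), hp,
    Polynomial.roots_multiset_prod_X_sub_C]

theorem eq_of_antitone_of_multiset_eq {N : ℕ} {a b : Fin N → ℝ} (ha : Antitone a)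
    (hb : Antitone b) (h : Finset.univ.val.map a = Finset.univ.val.map b) : a = b := by
  rw [← List.ofFn_inj]
  refine List.Perm.eq_of_pairwise' (r := (· ≥ ·)) ?_ ?_ ?_
  · rw [List.pairwise_ofFn]
    exact fun i j hij => ha hij.le
  · rw [List.pairwise_ofFn]
    exact fun i j hij => hb hij.le
  · rw [← Multiset.coe_eq_coe]
    simpa [Fin.univ_val_map] using h

/-- The half of the indices that represents `Fin n` up to reversal. -/
def halfIndex (n : ℕ) [NeZero n] (l : Fin ((n - 1) / 2 + 1)) : Fin n :=
  ⟨l, by have := NeZero.pos n; omega⟩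

theorem exists_halfIndex {n : ℕ} [NeZero n] (i : Fin n) :
    ∃ l, i = halfIndex n l ∨ i = Fin.rev (halfIndex n l) := by
  have := i.2
  by_cases h : (i : ℕ) ≤ (n - 1) / 2
  · exact ⟨⟨i, by omega⟩, Or.inl rfl⟩
  · refine ⟨⟨n - 1 - i, by omega⟩, Or.inr (Fin.ext ?_)⟩
    rw [Fin.val_rev]
    simp only [halfIndex]
    omega

/-- The spectra, in decreasing order, of multiples of elements of `B`. -/
def spectralCone (n : ℕ) [NeZero n] : Set (Fin n → ℝ) :=
  {a | (∀ i, a i.rev = -a i) ∧ Antitone a ∧ (StrictAnti fun l => a (halfIndex n l)) ∧ 0 < a 0}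

/-- All conditions are linear equations and inequalities, strict or weak. This convexity is half of
the connectedness of `B`. -/
theorem convex_spectralCone (n : ℕ) [NeZero n] : Convex ℝ (spectralCone n) := by
  rintro a ⟨ha1, ha2, ha3, ha4⟩ b ⟨hb1, hb2, hb3, hb4⟩ s t hs ht hst
  have hpos : ∀ x y x' y' : ℝ, x < x' → y < y' → s * x + t * y < s * x' + t * y' := by
    intro x y x' y' h1 h2
    rcases hs.eq_or_lt with rfl | hs'
    · have : t = 1 := by linarith
      simpa [this] using h2
    · exact add_lt_add_of_lt_of_le (mul_lt_mul_of_pos_left h1 hs')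
        (mul_le_mul_of_nonneg_left h2.le ht)
  refine ⟨fun i => ?_, fun i j hij => ?_, fun i j hij => ?_, ?_⟩
  · simp only [Pi.add_apply, Pi.smul_apply, smul_eq_mul, ha1, hb1]
    ring
  · exact add_le_add (mul_le_mul_of_nonneg_left (ha2 hij) hs)
      (mul_le_mul_of_nonneg_left (hb2 hij) ht)
  · exact hpos _ _ _ _ (ha3 hij) (hb3 hij)
  · simpa using hpos 0 0 (a 0) (b 0) ha4 hb4

theorem nonempty_spectralCone {n : ℕ} [NeZero n] (hn : 2 ≤ n) : (spectralCone n).Nonempty := by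
  -- The equally spaced spectrum `n - 1, n - 3, …, 1 - n`.
  refine ⟨fun i => n - 1 - 2 * (i : ℕ), fun i => ?_, fun i j hij => ?_, fun i j hij => ?_, ?_⟩
  · have h : (i : ℕ) + 1 ≤ n := i.2
    simp only
    rw [Fin.val_rev, Nat.cast_sub h]
    push_cast
    ring
  · have : ((i : ℕ) : ℝ) ≤ (j : ℕ) := by exact_mod_cast hij
    simp only
    linarith
  · have : ((i : ℕ) : ℝ) < (j : ℕ) := by exact_mod_cast hij
    simp only [halfIndex]
    linarith
  · have : (2 : ℝ) ≤ n := by exact_mod_cast hn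
    simp only [Fin.val_zero, Nat.cast_zero]
    linarith

theorem sum_odd_pow_eq_zero {n : ℕ} {a : Fin n → ℝ} (ha : ∀ i, a i.rev = -a i) (k : ℕ)
    (hk : Odd k) : ∑ i, a i ^ k = 0 := by
  have h : ∑ i, a i ^ k = -∑ i, a i ^ k := by
    conv_lhs => rw [← Equiv.sum_comp Fin.revPerm]
    simp [ha, hk.neg_pow]
  linarith

/-- Both `a` and `-a ∘ Fin.rev` are decreasing. Their even power sums agree trivially and the odd
ones vanish, so by Newton they coincide. -/
theorem rev_eq_neg_of_sum_odd_pow {n : ℕ} {a : Fin n → ℝ} (ha : Antitone a)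
    (h : ∀ k, Odd k → k ≤ n → ∑ i, a i ^ k = 0) (i : Fin n) : a i.rev = -a i := by
  have h1 : ∀ k, 1 ≤ k → k ≤ n → ∑ i, a i ^ k = ∑ i, (-a (Fin.rev i)) ^ k := by
    intro k _ hk
    have h2 : ∑ i, (-a (Fin.rev i)) ^ k = ∑ i, (-a i) ^ k :=
      Equiv.sum_comp Fin.revPerm fun i => (-a i) ^ k
    rw [h2]
    rcases Nat.even_or_odd k with he | ho
    · simp [he.neg_pow]
    · simp [ho.neg_pow, h k ho hk]
  have h2 : Antitone fun i => -a (Fin.rev i) := fun i j hij =>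
    neg_le_neg (ha (Fin.rev_le_rev.2 hij))
  have h3 := congrFun (eq_of_antitone_of_multiset_eq ha h2 (multiset_eq_of_sum_pow_eq h1)) i
  linarith

theorem sq_eq_halfIndex {n : ℕ} [NeZero n] {a : Fin n → ℝ} (ha : ∀ i, a i.rev = -a i) (i : Fin n) :
    ∃ l, a i ^ 2 = a (halfIndex n l) ^ 2 := by
  obtain ⟨l, rfl | rfl⟩ := exists_halfIndex i
  · exact ⟨l, rfl⟩
  · exact ⟨l, by rw [ha, neg_sq]⟩

/-- The even powers of an antisymmetric spectrum are independent if and only if the squares take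
the maximal number of different values. -/
theorem linearIndependent_even_pow_iff {n : ℕ} [NeZero n] {a : Fin n → ℝ}
    (ha : ∀ i, a i.rev = -a i) :
    (LinearIndependent ℝ fun j : Fin ((n - 1) / 2 + 1) => a ^ (2 * (j : ℕ))) ↔
      Function.Injective fun l => a (halfIndex n l) ^ 2 := by
  rw [Fintype.linearIndependent_iff]
  have key : ∀ g : Fin ((n - 1) / 2 + 1) → ℝ, ∑ j, g j • a ^ (2 * (j : ℕ)) = 0 ↔
      ∀ l, ∑ j, g j * (a (halfIndex n l) ^ 2) ^ (j : ℕ) = 0 := by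
    intro g
    rw [funext_iff]
    simp only [Finset.sum_apply, Pi.smul_apply, Pi.pow_apply, smul_eq_mul, pow_mul, Pi.zero_apply]
    refine ⟨fun h l => h _, fun h i => ?_⟩
    obtain ⟨l, hl⟩ := sq_eq_halfIndex ha i
    rw [hl]
    exact h l
  refine ⟨fun h => ?_, fun h g hg => ?_⟩
  -- By `key`, a relation is a polynomial of degree at most `(n - 1) / 2` vanishing at the `(n - 1)
  -- / 2 + 1` squares; a singular Vandermonde matrix would supply a nonzero one.
  · rw [← Matrix.det_vandermonde_ne_zero_iff]
    intro h0
    obtain ⟨g, hg0, hg⟩ := Matrix.exists_mulVec_eq_zero_iff.2 h0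
    refine hg0 (funext (h g ((key g).2 fun l => ?_)))
    have := congrFun hg l
    simpa [Matrix.mulVec, dotProduct, Matrix.vandermonde_apply, mul_comm] using this
  · exact congrFun (Matrix.eq_zero_of_forall_index_sum_mul_pow_eq_zero h ((key g).1 hg))

/-- The first half of a decreasing antisymmetric spectrum is nonnegative, so distinct squares mean
strict decrease. That `a ≠ 0` matters only when the half has a single entry; otherwise strict
decrease already gives `0 < a 0`. -/
theorem mem_spectralCone_iff {n : ℕ} [NeZero n] {a : Fin n → ℝ} (ha : Antitone a)
    (hrev : ∀ i, a i.rev = -a i) (hne : a ≠ 0) :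
    a ∈ spectralCone n ↔ Function.Injective fun l => a (halfIndex n l) ^ 2 := by
  have hnonneg : ∀ l, 0 ≤ a (halfIndex n l) := by
    intro l
    have h1 : halfIndex n l ≤ (halfIndex n l).rev := by
      rw [Fin.le_def, Fin.val_rev]
      simp only [halfIndex]
      omega
    have := ha h1
    rw [hrev] at this
    linarith
  refine ⟨fun h l m hlm => h.2.2.1.injective ?_, fun h => ⟨hrev, ha, fun l m hlm => ?_, ?_⟩⟩
  · exact (pow_left_inj₀ (hnonneg l) (hnonneg m) two_ne_zero).1 hlm
  · refine lt_of_le_of_ne (ha hlm.le) fun heq => hlm.ne' (h ?_)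
    simp only [heq]
  · have h0 : halfIndex n 0 = 0 := rfl
    refine lt_of_le_of_ne (h0 ▸ hnonneg 0) fun heq => hne (funext fun i => ?_)
    have h1 : a i ≤ a 0 := ha (Fin.zero_le i)
    have h2 : a i.rev ≤ a 0 := ha (Fin.zero_le _)
    rw [hrev] at h2
    simp only [Pi.zero_apply]
    linarith

end HermitianSphere

/-! ### The spectral description of `B`. -/

namespace HermitianSphere

open EuclideanSubmanifold Filter Topology Matrix

variable {n : ℕ} {F : Type*} [NormedRing F] [InnerProductSpace ℝ F]

attribute [local instance] matrixTopology matrixT2Space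

variable [StarRing F] [StarModule ℝ F] [HermitianAlgebra F]

/-- `Uᴴ * diag a * U` as a linear map of `a`. -/
def conjDiag (U : Matrix (Fin n) (Fin n) F) : (Fin n → ℝ) →ₗ[ℝ] Matrix (Fin n) (Fin n) F where
  toFun a := Uᴴ * rdiag a * U
  map_add' a b := by rw [rdiag_add, Matrix.mul_add, Matrix.add_mul]
  map_smul' r a := by simp [rdiag_smul]

theorem conjDiag_apply (U : Matrix (Fin n) (Fin n) F) (a : Fin n → ℝ) :
    conjDiag U a = Uᴴ * rdiag a * U := rfl

theorem conjDiag_conjTranspose (U : Matrix (Fin n) (Fin n) F) (a : Fin n → ℝ) :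
    (conjDiag U a)ᴴ = conjDiag U a := by
  rw [conjDiag_apply, conj_conjTranspose, rdiag_conjTranspose]

theorem conjDiag_mul {U : Matrix (Fin n) (Fin n) F} (hU : U ∈ unitaries n F) (a b : Fin n → ℝ) :
     conjDiag U (a * b) = conjDiag U a * conjDiag U b := by
  rw [conjDiag_apply, rdiag_mul, conj_mul hU]
  rfl

theorem conjDiag_pow {U : Matrix (Fin n) (Fin n) F} (hU : U ∈ unitaries n F) (a : Fin n → ℝ)
    (k : ℕ) : conjDiag U (a ^ k) = conjDiag U a ^ k := by
  rw [conjDiag_apply, rdiag_pow, ← conj_pow hU]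
  rfl

theorem conjDiag_one {U : Matrix (Fin n) (Fin n) F} (hU : U ∈ unitaries n F) :
    conjDiag U 1 = 1 := by
  rw [conjDiag_apply, rdiag_one, Matrix.mul_one, hU.2]

theorem reTrace_conjDiag {U : Matrix (Fin n) (Fin n) F} (hU : U ∈ unitaries n F) (a : Fin n → ℝ) :
    reTrace n F (conjDiag U a) = ∑ i, a i := by
  rw [conjDiag_apply, reTrace_conj hU, reTrace_rdiag]

theorem conjDiag_injective {U : Matrix (Fin n) (Fin n) F} (hU : U ∈ unitaries n F) :
    Function.Injective (conjDiag U) := fun _ _ h =>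
  rdiag_injective (conj_injective hU h)

theorem inner_coe (A X : E n F) :
    inner ℝ A X = reTrace n F ((A : Matrix (Fin n) (Fin n) F) * X) := by
  change inner ℝ (A : Matrix (Fin n) (Fin n) F) (X : Matrix (Fin n) (Fin n) F) = _
  rw [inner_eq_reTrace, coe_conjTranspose]

theorem f_of_eq_conjDiag {A : E n F} {U : Matrix (Fin n) (Fin n) F} (hU : U ∈ unitaries n F)
    {a : Fin n → ℝ} (hA : (A : Matrix (Fin n) (Fin n) F) = conjDiag U a) (k : ℕ) :
    f k A = ∑ i, a i ^ k := by
  rw [f_eq_reTrace, hA, ← conjDiag_pow hU, reTrace_conjDiag hU]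
  rfl

theorem norm_sq_of_eq_conjDiag {A : E n F} {U : Matrix (Fin n) (Fin n) F} (hU : U ∈ unitaries n F)
    {a : Fin n → ℝ} (hA : (A : Matrix (Fin n) (Fin n) F) = conjDiag U a) :
    ‖A‖ ^ 2 = ∑ i, a i ^ 2 := by
  rw [← real_inner_self_eq_norm_sq, inner_coe, ← sq, ← f_eq_reTrace, f_of_eq_conjDiag hU hA]

theorem sum_eq_zero_of_eq_conjDiag {A : E n F} {U : Matrix (Fin n) (Fin n) F}
    (hU : U ∈ unitaries n F) {a : Fin n → ℝ}
    (hA : (A : Matrix (Fin n) (Fin n) F) = conjDiag U a) : ∑ i, a i = 0 := by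
  rw [← reTrace_conjDiag hU, ← hA, reTrace_eq_zero]

theorem conjDiag_mem_E {U : Matrix (Fin n) (Fin n) F} (hU : U ∈ unitaries n F) {a : Fin n → ℝ}
    (ha : ∑ i, a i = 0) : conjDiag U a ∈ E n F :=
  mem_E_iff.2 ⟨conjDiag_conjTranspose U a, by rw [reTrace_conjDiag hU, ha]⟩

variable [FiniteDimensional ℝ F]

theorem exists_eq_conjDiag (A : E n F) : ∃ U ∈ unitaryComponent n F, ∃ a : Fin n → ℝ,
    Antitone a ∧ (A : Matrix (Fin n) (Fin n) F) = conjDiag U a :=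
  exists_diagonalization (coe_conjTranspose A)

/-- On Hermitian matrices `projE` kills exactly the multiples of `1`, so independence of the
projected powers amounts to independence of the powers with `A ^ 0 = 1` adjoined. -/
theorem linearIndependent_evenNormal_iff [NeZero n] (A : E n F) :
    LinearIndependent ℝ (fun j : Fin ((n - 1) / 2) => evenNormal j A) ↔
      LinearIndependent ℝ fun j : Fin ((n - 1) / 2 + 1) =>
        (A : Matrix (Fin n) (Fin n) F) ^ (2 * (j : ℕ)) := by
  rw [Fintype.linearIndependent_iff, Fintype.linearIndependent_iff]
  have hproj : ∀ g : Fin ((n - 1) / 2) → ℝ, ∑ j, g j • evenNormal j A =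
      projE n F (∑ j, g j • (A : Matrix (Fin n) (Fin n) F) ^ (2 * (j : ℕ) + 2)) := by
    intro g
    rw [map_sum]
    exact Finset.sum_congr rfl fun j _ => (map_smul (projE n F) _ _).symm
  refine ⟨fun h g hg => ?_, fun h g hg => ?_⟩
  · rw [Fin.sum_univ_succ] at hg
    simp only [Fin.val_zero, mul_zero, pow_zero, Fin.val_succ] at hg
    have h1 := congrArg (projE n F) hg
    rw [map_add, map_smul, projE_one, smul_zero, zero_add, map_zero] at h1
    have h2 : ∀ j, g (Fin.succ j) = 0 := h (fun j => g j.succ) ((hproj _).trans h1)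
    simp only [h2, zero_smul, Finset.sum_const_zero, add_zero] at hg
    have h3 := congrArg (reTrace n F) hg
    rw [map_smul, reTrace_one, map_zero, smul_eq_mul] at h3
    exact Fin.cases ((mul_eq_zero.1 h3).resolve_right (NeZero.ne _)) h2
  · rw [hproj] at hg
    set T := ∑ j, g j • (A : Matrix (Fin n) (Fin n) F) ^ (2 * (j : ℕ) + 2) with hT
    have hTH : Tᴴ = T := by
      simp only [hT, conjTranspose_sum, conjTranspose_smul, pow_conjTranspose, star_trivial]
    have h1 : T - (reTrace n F T / n) • 1 = 0 := by
      rw [← coe_projE hTH, hg]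
      rfl
    -- The coefficient of `1` is the scalar that the projection subtracts.
    have h2 := h (Fin.cons (-(reTrace n F T / n)) g) (by
      rw [Fin.sum_univ_succ]
      simp only [Fin.val_zero, mul_zero, pow_zero, Fin.val_succ, Fin.cons_zero, Fin.cons_succ]
      rw [neg_smul, neg_add_eq_sub]
      exact h1)
    exact fun j => h2 j.succ

theorem linearIndependent_pow_of_eq_conjDiag {A : E n F} {U : Matrix (Fin n) (Fin n) F}
    (hU : U ∈ unitaries n F) {a : Fin n → ℝ}
    (hA : (A : Matrix (Fin n) (Fin n) F) = conjDiag U a) :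
    LinearIndependent ℝ (fun j : Fin ((n - 1) / 2 + 1) =>
        (A : Matrix (Fin n) (Fin n) F) ^ (2 * (j : ℕ))) ↔
      LinearIndependent ℝ fun j : Fin ((n - 1) / 2 + 1) => a ^ (2 * (j : ℕ)) := by
  rw [← LinearMap.linearIndependent_iff (conjDiag U)
    (LinearMap.ker_eq_bot.2 (conjDiag_injective hU))]
  simp only [hA, ← conjDiag_pow hU]
  rfl

theorem sum_odd_pow_eq_zero_of_Phi {A : E n F} (hA : Phi A = 0) {U : Matrix (Fin n) (Fin n) F}
    (hU : U ∈ unitaries n F) {a : Fin n → ℝ}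
    (hAa : (A : Matrix (Fin n) (Fin n) F) = conjDiag U a) (k : ℕ) (hk : Odd k) (hkn : k ≤ n) :
    ∑ i, a i ^ k = 0 := by
  obtain ⟨j, rfl⟩ := hk
  -- The exponent `1` is the trace condition; an odd exponent `2 * j + 3 ≤ n` has `j < (n - 1) / 2`
  -- and is the `j`-th component of `Phi`.
  rcases j with _ | j
  · simpa using sum_eq_zero_of_eq_conjDiag hU hAa
  · rw [← f_of_eq_conjDiag hU hAa]
    exact congrFun hA ⟨j, by omega⟩

theorem mem_B_iff_linearIndependent {A : E n F} : A ∈ B n F ↔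
    ‖A‖ = 1 ∧ Phi A = 0 ∧ LinearIndependent ℝ fun j : Fin ((n - 1) / 2) => evenNormal j A :=
  (homogeneousSystem_Phi (n := n) (F := F)).mem_regularSet_iff

/-- Norm, odd traces and independence of even powers are all functions of the spectrum. Here `U` may
be any unitary matrix, which the austerity argument needs. -/
theorem mem_B_iff [NeZero n] {A : E n F} {U : Matrix (Fin n) (Fin n) F} (hU : U ∈ unitaries n F)
    {a : Fin n → ℝ} (ha : Antitone a) (hA : (A : Matrix (Fin n) (Fin n) F) = conjDiag U a) :
    A ∈ B n F ↔ ∑ i, a i ^ 2 = 1 ∧ a ∈ spectralCone n := by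
  rw [mem_B_iff_linearIndependent, linearIndependent_evenNormal_iff,
    linearIndependent_pow_of_eq_conjDiag hU hA, ← norm_sq_of_eq_conjDiag hU hA,
    pow_eq_one_iff_of_nonneg (norm_nonneg _) two_ne_zero]
  refine and_congr_right fun hnorm => ?_
  have hne : a ≠ 0 := by
    rintro rfl
    have := norm_sq_of_eq_conjDiag hU hA
    rw [hnorm] at this
    simp at this
  constructor
  · rintro ⟨h1, h2⟩
    have hrev := rev_eq_neg_of_sum_odd_pow ha (sum_odd_pow_eq_zero_of_Phi h1 hU hA)
    rwa [mem_spectralCone_iff ha hrev hne, ← linearIndependent_even_pow_iff hrev]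
  · intro h
    refine ⟨funext fun j => ?_, ?_⟩
    · exact (f_of_eq_conjDiag hU hA _).trans (sum_odd_pow_eq_zero h.1 _ ⟨j + 1, by ring⟩)
    · rwa [linearIndependent_even_pow_iff h.1, ← mem_spectralCone_iff ha h.1 hne]

theorem exists_spectrum_of_mem_B [NeZero n] {A : E n F} (hA : A ∈ B n F) :
    ∃ U ∈ unitaryComponent n F, ∃ a ∈ spectralCone n, ∑ i, a i ^ 2 = 1 ∧
      (A : Matrix (Fin n) (Fin n) F) = conjDiag U a := by
  obtain ⟨U, hU, a, ha, hAa⟩ := exists_eq_conjDiag A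
  obtain ⟨h1, h2⟩ := (mem_B_iff (unitaryComponent_subset hU) ha hAa).1 hA
  exact ⟨U, hU, a, h2, h1, hAa⟩

end HermitianSphere

/-! ### Connectedness, fullness and austerity of `B`. -/

namespace EuclideanSubmanifold

theorem isFull_of_forall_inner_eq_zero {V : Type*} [NormedAddCommGroup V] [InnerProductSpace ℝ V]
    [FiniteDimensional ℝ V] {M : Set V}
    (h : ∀ X, (∀ A ∈ M, inner ℝ A X = 0) → X = 0) : IsFull M := by
  intro W hW
  rw [← Submodule.orthogonal_eq_bot_iff, Submodule.eq_bot_iff]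
  exact fun X hX => h X fun A hA => hX A (hW hA)

end EuclideanSubmanifold

namespace HermitianSphere

open EuclideanSubmanifold Filter Topology Matrix

section Spectra

variable {n : ℕ} [NeZero n]

theorem smul_mem_spectralCone {a : Fin n → ℝ} (ha : a ∈ spectralCone n) {r : ℝ} (hr : 0 < r) :
    r • a ∈ spectralCone n := by
  obtain ⟨h1, h2, h3, h4⟩ := ha
  refine ⟨fun i => ?_, fun i j hij => ?_, fun i j hij => ?_, mul_pos hr h4⟩
  · simp [h1]
  · exact mul_le_mul_of_nonneg_left (h2 hij) hr.le
  · exact mul_lt_mul_of_pos_left (h3 hij) hr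

/-- The spectrum scaled to length one. -/
def unitSpectrum (a : Fin n → ℝ) : Fin n → ℝ := (√(∑ i, a i ^ 2))⁻¹ • a

theorem sum_sq_pos {a : Fin n → ℝ} (ha : a ∈ spectralCone n) : 0 < ∑ i, a i ^ 2 :=
  Finset.sum_pos' (fun _ _ => sq_nonneg _) ⟨0, Finset.mem_univ _, pow_pos ha.2.2.2 2⟩

theorem unitSpectrum_mem {a : Fin n → ℝ} (ha : a ∈ spectralCone n) :
    unitSpectrum a ∈ spectralCone n :=
  smul_mem_spectralCone ha (inv_pos.2 (Real.sqrt_pos.2 (sum_sq_pos ha)))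

theorem sum_unitSpectrum_sq {a : Fin n → ℝ} (ha : a ∈ spectralCone n) :
    ∑ i, unitSpectrum a i ^ 2 = 1 := by
  simp only [unitSpectrum, Pi.smul_apply, smul_eq_mul, mul_pow, ← Finset.mul_sum, inv_pow]
  rw [Real.sq_sqrt (sum_sq_pos ha).le, inv_mul_cancel₀ (sum_sq_pos ha).ne']

theorem unitSpectrum_eq_self {a : Fin n → ℝ} (ha : ∑ i, a i ^ 2 = 1) : unitSpectrum a = a := by
  simp [unitSpectrum, ha]

theorem continuousOn_unitSpectrum :
    ContinuousOn (unitSpectrum : (Fin n → ℝ) → Fin n → ℝ) (spectralCone n) := by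
  refine ContinuousOn.smul (ContinuousOn.inv₀ (Continuous.continuousOn
    (Real.continuous_sqrt.comp (continuous_finsetSum _ fun i _ => (continuous_apply i).pow 2))) ?_)
    continuousOn_id
  exact fun a ha => (Real.sqrt_pos.2 (sum_sq_pos ha)).ne'

theorem sum_eq_zero_of_mem_spectralCone {a : Fin n → ℝ} (ha : a ∈ spectralCone n) :
    ∑ i, a i = 0 := by
  simpa using sum_odd_pow_eq_zero ha.1 1 odd_one

/-- By antisymmetry of `a`, also `∑ a i * (d i - d i.rev) = 0`. Both factors have the same sign, so
every term vanishes; the term `i = 0`, where `a 0 > 0`, forces the extreme values of `d` to agree,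
and a constant with sum zero is zero. -/
theorem eq_zero_of_sum_mul_eq_zero {a d : Fin n → ℝ} (ha : a ∈ spectralCone n) (hd : Antitone d)
    (hsum : ∑ i, d i = 0) (h : ∑ i, a i * d i = 0) : d = 0 := by
  obtain ⟨hrev, hanti, -, hpos⟩ := ha
  have h1 : ∑ i, a i * d (Fin.rev i) = 0 := by
    rw [← neg_eq_zero, ← h, ← Finset.sum_neg_distrib, ← Equiv.sum_comp Fin.revPerm]
    simp [hrev]
  have h2 : ∑ i, a i * (d i - d (Fin.rev i)) = 0 := by
    simp only [mul_sub, Finset.sum_sub_distrib, h, h1, sub_zero]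
  have h3 : ∀ i ∈ Finset.univ, 0 ≤ a i * (d i - d (Fin.rev i)) := by
    intro i _
    rcases le_total i i.rev with hi | hi
    · have := hanti hi
      rw [hrev] at this
      exact mul_nonneg (by linarith) (sub_nonneg.2 (hd hi))
    · have := hanti hi
      rw [hrev] at this
      exact mul_nonneg_of_nonpos_of_nonpos (by linarith) (sub_nonpos.2 (hd hi))
  have h4 := (Finset.sum_eq_zero_iff_of_nonneg h3).1 h2 0 (Finset.mem_univ _)
  have h5 : d 0 = d (Fin.rev 0) := sub_eq_zero.1 ((mul_eq_zero.1 h4).resolve_left hpos.ne')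
  have h6 : ∀ i, d i = d 0 := fun i =>
    le_antisymm (hd (Fin.zero_le i)) (h5 ▸ hd (by
      rw [← Fin.rev_rev i]
      exact Fin.rev_le_rev.2 (Fin.zero_le _)))
  simp only [h6, Finset.sum_const, Finset.card_univ, Fintype.card_fin, nsmul_eq_mul] at hsum
  have h7 := (mul_eq_zero.1 hsum).resolve_left (NeZero.ne _)
  exact funext fun i => (h6 i).trans h7

end Spectra

variable {n : ℕ} {F : Type*} [NormedRing F] [InnerProductSpace ℝ F]

attribute [local instance] matrixTopology matrixT2Space

variable [StarRing F] [StarModule ℝ F] [HermitianAlgebra F]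

section

attribute [local instance] matrixNormedRing matrixNormedAlgebra matrixTopology

theorem continuous_conjDiag [FiniteDimensional ℝ F] :
    Continuous fun q : Matrix (Fin n) (Fin n) F × (Fin n → ℝ) => conjDiag q.1 q.2 := by
  have h1 : Continuous (rdiagₗ n F) := (rdiagₗ n F).continuous_of_finiteDimensional
  exact ((continuous_conjTranspose.comp continuous_fst).mul (h1.comp continuous_snd)).mul
    continuous_fst

end

variable [FiniteDimensional ℝ F]

theorem projE_conjDiag_mem_B [NeZero n] {U : Matrix (Fin n) (Fin n) F} (hU : U ∈ unitaries n F)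
    {a : Fin n → ℝ} (ha : a ∈ spectralCone n) (h1 : ∑ i, a i ^ 2 = 1) :
    projE n F (conjDiag U a) ∈ B n F ∧
      (projE n F (conjDiag U a) : Matrix (Fin n) (Fin n) F) = conjDiag U a := by
  have h2 : (projE n F (conjDiag U a) : Matrix (Fin n) (Fin n) F) = conjDiag U a :=
    congrArg Subtype.val (projE_coe ⟨_, conjDiag_mem_E hU (sum_eq_zero_of_mem_spectralCone ha)⟩)
  exact ⟨(mem_B_iff hU ha.2.1 h2).2 ⟨h1, ha⟩, h2⟩

/-- Rescaling by `unitSpectrum` allows the convex cone as parameter space instead of its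
intersection with the sphere; `projE` only places the values in `E n F`. -/
theorem B_eq_image [NeZero n] : B n F =
    (fun q : Matrix (Fin n) (Fin n) F × (Fin n → ℝ) =>
      projE n F (conjDiag q.1 (unitSpectrum q.2))) '' (unitaryComponent n F ×ˢ spectralCone n) := by
  ext A
  constructor
  · intro hA
    obtain ⟨U, hU, a, ha, h1, h2⟩ := exists_spectrum_of_mem_B hA
    refine ⟨(U, a), ⟨hU, ha⟩, ?_⟩
    simp only [unitSpectrum_eq_self h1]
    rw [← h2, projE_coe]
  · rintro ⟨⟨U, a⟩, ⟨hU, ha⟩, rfl⟩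
    exact (projE_conjDiag_mem_B (unitaryComponent_subset hU) (unitSpectrum_mem ha)
      (sum_unitSpectrum_sq ha)).1

theorem continuousOn_projE_conjDiag_unitSpectrum [NeZero n] :
    ContinuousOn (fun q : Matrix (Fin n) (Fin n) F × (Fin n → ℝ) =>
      projE n F (conjDiag q.1 (unitSpectrum q.2))) (unitaryComponent n F ×ˢ spectralCone n) := by
  have h1 : ContinuousOn (fun q : Matrix (Fin n) (Fin n) F × (Fin n → ℝ) => unitSpectrum q.2)
      (unitaryComponent n F ×ˢ spectralCone n) :=
    continuousOn_unitSpectrum.comp (t := spectralCone n) continuousOn_snd fun _ hq => hq.2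
  have h2 : ContinuousOn (fun q : Matrix (Fin n) (Fin n) F × (Fin n → ℝ) =>
      (q.1, unitSpectrum q.2)) (unitaryComponent n F ×ˢ spectralCone n) :=
    continuousOn_fst.prodMk h1
  have h3 : ContinuousOn ((fun q : Matrix (Fin n) (Fin n) F × (Fin n → ℝ) => conjDiag q.1 q.2) ∘
      fun q : Matrix (Fin n) (Fin n) F × (Fin n → ℝ) => (q.1, unitSpectrum q.2))
      (unitaryComponent n F ×ˢ spectralCone n) := by
    refine Continuous.comp_continuousOn ?_ h2
    exact continuous_conjDiag
  exact (projE n F).continuous.comp_continuousOn h3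

theorem isConnected_B (hn : 2 ≤ n) : IsConnected (B n F) := by
  have : NeZero n := ⟨by omega⟩
  have h : IsPreconnected (unitaryComponent n F ×ˢ spectralCone n) :=
    isPreconnected_unitaryComponent.prod (convex_spectralCone n).isPreconnected
  rw [B_eq_image]
  exact ⟨Set.Nonempty.image _ (Set.Nonempty.prod ⟨1, one_mem_unitaryComponent⟩
    (nonempty_spectralCone hn)), h.image _ continuousOn_projE_conjDiag_unitSpectrum⟩

/-- The test element of `B` has the same diagonalizing `U` as `X`, so that their inner product is
the sum of products of eigenvalues in the same order. -/
theorem isFull_B (hn : 2 ≤ n) : IsFull (B n F) := by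
  have : NeZero n := ⟨by omega⟩
  refine isFull_of_forall_inner_eq_zero fun X hX => ?_
  obtain ⟨U, hU, d, hd, hXd⟩ := exists_eq_conjDiag X
  have hU := unitaryComponent_subset hU
  obtain ⟨a, ha⟩ := nonempty_spectralCone hn
  obtain ⟨hB, hcoe⟩ := projE_conjDiag_mem_B hU (unitSpectrum_mem ha) (sum_unitSpectrum_sq ha)
  have h := hX _ hB
  rw [inner_coe, hcoe, hXd, ← conjDiag_mul hU, reTrace_conjDiag hU] at h
  have hd0 := eq_zero_of_sum_mul_eq_zero (unitSpectrum_mem ha) hd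
    (sum_eq_zero_of_eq_conjDiag hU hXd) h
  rw [hd0, map_zero] at hXd
  exact Subtype.ext hXd

variable (n F) in
/-- The permutation matrix that reverses the order of the basis. -/
def reversal : Matrix (Fin n) (Fin n) F := Matrix.of fun i j => if j = Fin.rev i then 1 else 0

theorem reversal_conjTranspose : (reversal n F)ᴴ = reversal n F := by
  ext i j
  simp only [reversal, Matrix.conjTranspose_apply, Matrix.of_apply, apply_ite star, star_one,
    star_zero, ← Fin.rev_eq_iff (i := j), eq_comm]

theorem reversal_mul (A : Matrix (Fin n) (Fin n) F) :
    reversal n F * A = A.submatrix Fin.rev id := by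
  ext i j
  simp [reversal, Matrix.mul_apply]

theorem mul_reversal (A : Matrix (Fin n) (Fin n) F) :
    A * reversal n F = A.submatrix id Fin.rev := by
  have h := congrArg Matrix.conjTranspose (reversal_mul Aᴴ)
  rwa [conjTranspose_mul, conjTranspose_conjTranspose, reversal_conjTranspose,
    conjTranspose_submatrix, conjTranspose_conjTranspose] at h

theorem reversal_mul_self : reversal n F * reversal n F = 1 := by
  rw [reversal_mul]
  ext i j
  simp [reversal, Matrix.one_apply, eq_comm]

theorem conjDiag_reversal_mul (U : Matrix (Fin n) (Fin n) F) (a : Fin n → ℝ) :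
    conjDiag (reversal n F * U) a = conjDiag U (a ∘ Fin.rev) := by
  have h : reversal n F * rdiag a * reversal n F = rdiag (a ∘ Fin.rev) := by
    rw [reversal_mul, mul_reversal]
    ext i j
    simp [rdiag, Matrix.diagonal_apply]
  rw [conjDiag_apply, conjDiag_apply, conjTranspose_mul, reversal_conjTranspose, ← h]
  simp only [Matrix.mul_assoc]

theorem conjDiag_mul_right (U R : Matrix (Fin n) (Fin n) F) (a : Fin n → ℝ) :
    conjDiag (U * R) a = Rᴴ * conjDiag U a * R := by
  rw [conjDiag_apply, conjDiag_apply, conjTranspose_mul]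
  simp only [Matrix.mul_assoc]

theorem reversal_mem_unitaries : reversal n F ∈ unitaries n F := by
  simp [unitaries, reversal_conjTranspose, reversal_mul_self]

/-- The negative of the conjugation by a unitary matrix. -/
def negConj {R : Matrix (Fin n) (Fin n) F} (hR : R ∈ unitaries n F) : E n F →ₗ[ℝ] E n F where
  toFun Y := ⟨-(Rᴴ * Y * R), mem_E_iff.2 ⟨by
    rw [conjTranspose_neg, conj_conjTranspose, coe_conjTranspose], by
    rw [map_neg, reTrace_conj hR, reTrace_eq_zero, neg_zero]⟩⟩
  map_add' X Y := Subtype.ext (by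
    change -(Rᴴ * ((X : Matrix (Fin n) (Fin n) F) + Y) * R) = -(Rᴴ * X * R) + -(Rᴴ * Y * R)
    rw [Matrix.mul_add, Matrix.add_mul, neg_add])
  map_smul' r X := Subtype.ext (by
    change -(Rᴴ * (r • (X : Matrix (Fin n) (Fin n) F)) * R) = r • -(Rᴴ * X * R)
    rw [Matrix.mul_smul, Matrix.smul_mul, smul_neg])

theorem coe_negConj {R : Matrix (Fin n) (Fin n) F} (hR : R ∈ unitaries n F) (Y : E n F) :
    (negConj hR Y : Matrix (Fin n) (Fin n) F) = -(Rᴴ * Y * R) := rfl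

/-- The spectrum of `-Rᴴ Y R` is the negative of that of `Y`, which is the same spectrum reversed;
an extra factor `reversal` restores the decreasing order. -/
theorem negConj_mem_B [NeZero n] {R : Matrix (Fin n) (Fin n) F} (hR : R ∈ unitaries n F)
    {Y : E n F} (hY : Y ∈ B n F) : negConj hR Y ∈ B n F := by
  obtain ⟨V, hV, b, hb, h1, h2⟩ := exists_spectrum_of_mem_B hY
  have hV := unitaryComponent_subset hV
  refine (mem_B_iff (U := reversal n F * (V * R))
    (mul_mem_unitaries reversal_mem_unitaries (mul_mem_unitaries hV hR)) hb.2.1 ?_).2 ⟨h1, hb⟩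
  have h3 : b ∘ Fin.rev = -b := funext hb.1
  rw [conjDiag_reversal_mul, conjDiag_mul_right, h3, map_neg, ← h2, coe_negConj, Matrix.mul_neg,
    Matrix.neg_mul]

theorem negConj_involutive {R : Matrix (Fin n) (Fin n) F} (hR : R ∈ unitaries n F)
    (hRH : Rᴴ = R) (Y : E n F) : negConj hR (negConj hR Y) = Y := by
  have hR2 : R * R = 1 := by simpa [hRH] using hR.1
  refine Subtype.ext ?_
  rw [coe_negConj, coe_negConj, hRH, Matrix.mul_neg, Matrix.neg_mul, neg_neg]
  simp only [← Matrix.mul_assoc, hR2, Matrix.one_mul]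
  rw [Matrix.mul_assoc, hR2, Matrix.mul_one]

theorem inner_negConj {R : Matrix (Fin n) (Fin n) F} (hR : R ∈ unitaries n F)
    (hRH : Rᴴ = R) (Y Z : E n F) :
    inner ℝ (negConj hR Y) Z = inner ℝ Y (negConj hR Z) := by
  rw [inner_coe, inner_coe, coe_negConj, coe_negConj, hRH, Matrix.neg_mul, Matrix.mul_neg, map_neg,
    map_neg]
  simp only [Matrix.mul_assoc]
  rw [reTrace_mul_comm]
  simp only [Matrix.mul_assoc]

/-- `R = Uᴴ * reversal * U` swaps the eigenvectors for `a i` and `a i.rev = -a i`. So it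
anticommutes with `x` and commutes with the even powers of `x`; the negative of the conjugation by
`R` fixes `x` and reverses the normal frame. -/
theorem isAustere_B [NeZero n] : IsAustere (S n F) (B n F) := by
  refine (homogeneousSystem_Phi (n := n) (F := F)).isAustere fun x hx => ?_
  obtain ⟨U, hU, a, ha, -, hxa⟩ := exists_spectrum_of_mem_B hx
  have hU := unitaryComponent_subset hU
  set R := Uᴴ * reversal n F * U with hR
  have hRH : Rᴴ = R := by rw [hR, conj_conjTranspose, reversal_conjTranspose]
  have hRR : R * R = 1 := by
    rw [hR, ← conj_mul hU, reversal_mul_self, Matrix.mul_one, hU.2]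
  have hRU : R ∈ unitaries n F := ⟨by rw [hRH, hRR], by rw [hRH, hRR]⟩
  have hconj : ∀ e : Fin n → ℝ, Rᴴ * conjDiag U e * R = conjDiag U (e ∘ Fin.rev) := by
    intro e
    rw [← conjDiag_mul_right, hR, ← Matrix.mul_assoc, ← Matrix.mul_assoc, hU.1, Matrix.one_mul,
      conjDiag_reversal_mul]
  refine ⟨(negConj hRU).toContinuousLinearMap, fun y hy => negConj_mem_B hRU hy,
    negConj_involutive hRU hRH, inner_negConj hRU hRH, Subtype.ext ?_, fun j => Subtype.ext ?_⟩
  · change (negConj hRU x : Matrix (Fin n) (Fin n) F) = _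
    rw [coe_negConj, hxa, hconj, show a ∘ Fin.rev = -a from funext ha.1, map_neg, neg_neg]
  · change (negConj hRU (evenNormal j x) : Matrix (Fin n) (Fin n) F) =
      -(evenNormal j x : Matrix (Fin n) (Fin n) F)
    have h1 : (evenNormal j x : Matrix (Fin n) (Fin n) F) =
        conjDiag U (a ^ (2 * (j : ℕ) + 2) -
          (reTrace n F ((x : Matrix (Fin n) (Fin n) F) ^ (2 * (j : ℕ) + 2)) / n) • 1) := by
      rw [evenNormal, coe_projE (pow_conjTranspose x _), map_sub, map_smul, conjDiag_one hU,
        conjDiag_pow hU, ← hxa]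
    rw [coe_negConj, h1, hconj]
    congr 2
    ext i
    have h2 : Even (2 * (j : ℕ) + 2) := ⟨j + 1, by ring⟩
    simp [ha.1, h2.neg_pow]

end HermitianSphere

/-! ### The dimension of `E n F`. -/

namespace HermitianSphere

open EuclideanSubmanifold Filter Topology Matrix

variable {n : ℕ} {F : Type*} [NormedRing F] [InnerProductSpace ℝ F]

attribute [local instance] matrixTopology matrixT2Space

variable [StarRing F] [StarModule ℝ F] [HermitianAlgebra F]

variable (n F) in
/-- The entries above the diagonal of a traceless Hermitian matrix, and the entries on the
diagonal of its sum with a multiple of the unit matrix. -/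
def coordinates : E n F × ℝ →ₗ[ℝ] ((Σ j : Fin n, Fin j) → F) × (Fin n → ℝ) where
  toFun q := (fun s => (q.1 : Matrix (Fin n) (Fin n) F) (s.2.castLE s.1.2.le) s.1,
    fun i => inner ℝ (1 : F) ((q.1 : Matrix (Fin n) (Fin n) F) i i) + q.2)
  map_add' q q' := by
    ext
    · simp
    · simp [inner_add_right]
      ring
  map_smul' r q := by
    ext
    · simp
    · simp [inner_smul_right, mul_add]

/-- Summing the diagonal equations of an element `(A, t)` of the kernel gives `n t = 0`, as `A` is
traceless. -/
theorem coordinates_injective [NeZero n] : Function.Injective (coordinates n F) := by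
  rw [← LinearMap.ker_eq_bot, Submodule.eq_bot_iff]
  rintro ⟨A, t⟩ h
  rw [LinearMap.mem_ker] at h
  have h1 : ∀ s : Σ j : Fin n, Fin j,
      (A : Matrix (Fin n) (Fin n) F) (s.2.castLE s.1.2.le) s.1 = 0 :=
    congrFun (congrArg Prod.fst h)
  have h2 : ∀ i, inner ℝ (1 : F) ((A : Matrix (Fin n) (Fin n) F) i i) + t = 0 :=
    congrFun (congrArg Prod.snd h)
  have ht : t = 0 := by
    have h3 := Finset.sum_congr rfl fun i (_ : i ∈ Finset.univ) => h2 i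
    rw [Finset.sum_add_distrib, ← reTrace_apply, reTrace_eq_zero] at h3
    simpa [NeZero.ne n] using h3
  subst ht
  have hupper : ∀ i j : Fin n, i < j → (A : Matrix (Fin n) (Fin n) F) i j = 0 := fun i j hij =>
    h1 ⟨j, ⟨i, hij⟩⟩
  refine Prod.ext (Subtype.ext (Matrix.ext fun i j => ?_)) rfl
  have hH : ∀ i j, star ((A : Matrix (Fin n) (Fin n) F) j i) =
      (A : Matrix (Fin n) (Fin n) F) i j := fun i j => congrFun (congrFun (coe_conjTranspose A) i) j
  rcases lt_trichotomy i j with hij | rfl | hij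
  · exact hupper i j hij
  · rw [HermitianAlgebra.eq_re_smul_one _ (hH i i), ← add_zero (inner ℝ 1 _), h2 i, zero_smul]
    rfl
  · rw [← hH, hupper j i hij, star_zero]
    rfl

variable [FiniteDimensional ℝ F]

/-- The data determine a Hermitian matrix, which splits into its traceless part and its mean
diagonal value. -/
theorem coordinates_surjective [NeZero n] : Function.Surjective (coordinates n F) := by
  rintro ⟨u, d⟩
  let M : Matrix (Fin n) (Fin n) F := Matrix.of fun i j =>
    if h : i < j then u ⟨j, ⟨i, h⟩⟩ else if h : j < i then star (u ⟨i, ⟨j, h⟩⟩) else d i • 1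
  have hM : Mᴴ = M := by
    ext i j
    rcases lt_trichotomy i j with hij | rfl | hij
    · simp [M, hij, hij.not_gt]
    · simp [M]
    · simp [M, hij, hij.not_gt]
  refine ⟨(projE n F M, reTrace n F M / n), ?_⟩
  simp only [coordinates, LinearMap.coe_mk, AddHom.coe_mk, coe_projE hM]
  refine Prod.ext (funext fun ⟨j, i⟩ => ?_) (funext fun i => ?_)
  · have h1 : Fin.castLE j.2.le i < j := i.2
    simp [M, h1, h1.ne]
  · simp [M, inner_sub_right, inner_smul_right, HermitianAlgebra.norm_one]

theorem finrank_E [NeZero n] : Module.finrank ℝ (E n F) = N n F := by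
  have h := (LinearEquiv.ofBijective (coordinates n F)
    ⟨coordinates_injective, coordinates_surjective⟩).finrank_eq
  rw [Module.finrank_prod, Module.finrank_prod, Module.finrank_self,
    Module.finrank_fintype_fun_eq_card, Module.finrank_pi_fintype, Finset.sum_const, smul_eq_mul, Finset.card_univ,
    Fintype.card_sigma] at h
  simp only [Fintype.card_fin] at h
  rw [Fin.sum_univ_eq_sum_range (fun j => j), Finset.sum_range_id] at h
  rw [N]
  omega

/-- For `n ≥ 2` one has `(n - 1) / 2 + 1 ≤ n - 1`, so no subtraction of natural numbers is
truncated. -/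
theorem codim_add (hn : 2 ≤ n) :
    N n F - (n - 1) / 2 - 1 + ((n - 1) / 2 + 1) = Module.finrank ℝ (E n F) := by
  have : NeZero n := ⟨by omega⟩
  rw [finrank_E, N]
  generalize n * (n - 1) / 2 * Module.finrank ℝ F = k
  omega

end HermitianSphere

/-! ### Power sums as coordinates; Lagrange polynomials. -/

namespace HermitianSphere

open EuclideanSubmanifold Filter Topology

/-- The power sums `p_1, …, p_q` of `q` variables. -/
def powerSums {q : ℕ} (m : Fin q → ℝ) : Fin q → ℝ := fun k => ∑ l, m l ^ ((k : ℕ) + 1)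

theorem contDiff_powerSums {q : ℕ} : ContDiff ℝ ∞ (powerSums : (Fin q → ℝ) → Fin q → ℝ) :=
  contDiff_pi.2 fun _ => ContDiff.sum fun l _ => (contDiff_apply ℝ ℝ l).pow _

/-- The derivative of the power sums. -/
def powerSumsDeriv {q : ℕ} (m : Fin q → ℝ) : (Fin q → ℝ) →L[ℝ] Fin q → ℝ :=
  ContinuousLinearMap.pi fun k =>
    ∑ l, (((k : ℕ) + 1 : ℝ) * m l ^ (k : ℕ)) • ContinuousLinearMap.proj l

theorem powerSumsDeriv_apply {q : ℕ} (m h : Fin q → ℝ) (k : Fin q) :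
    powerSumsDeriv m h k = ((k : ℕ) + 1 : ℝ) * ∑ l, h l * m l ^ (k : ℕ) := by
  simp only [powerSumsDeriv, ContinuousLinearMap.coe_pi', _root_.sum_apply, _root_.smul_apply,
    ContinuousLinearMap.proj_apply, smul_eq_mul, Finset.mul_sum]
  exact Finset.sum_congr rfl fun l _ => by ring

theorem hasFDerivAt_powerSums {q : ℕ} (m : Fin q → ℝ) :
    HasFDerivAt powerSums (powerSumsDeriv m) m := by
  refine hasFDerivAt_pi.2 fun k => HasFDerivAt.fun_sum fun l _ => ?_
  have h := (hasFDerivAt_apply (𝕜 := ℝ) l m).pow ((k : ℕ) + 1)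
  simpa using h

/-- The derivative is a Vandermonde matrix with rows scaled by `k + 1`. -/
theorem powerSumsDeriv_injective {q : ℕ} {m : Fin q → ℝ} (hm : Function.Injective m) :
    Function.Injective (powerSumsDeriv m) := by
  rw [injective_iff_map_eq_zero]
  intro h hh
  refine Matrix.eq_zero_of_forall_pow_sum_mul_pow_eq_zero hm fun k => ?_
  have h1 := congrFun hh k
  rw [powerSumsDeriv_apply, Pi.zero_apply] at h1
  exact (mul_eq_zero.1 h1).resolve_left (by positivity)

/-- Near distinct points, the points and their Lagrange polynomials depend smoothly on the power
sums. -/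
theorem exists_smooth_lagrange {q : ℕ} {μ : Fin q → ℝ} (hμ : Function.Injective μ) :
    ∃ (T : Set (Fin q → ℝ)) (m : (Fin q → ℝ) → Fin q → ℝ)
      (C : Fin q → Fin q → (Fin q → ℝ) → ℝ), IsOpen T ∧ powerSums μ ∈ T ∧
      m (powerSums μ) = μ ∧ (∀ l k, ContDiffOn ℝ ∞ (C l k) T) ∧
      ∀ z ∈ T, powerSums (m z) = z ∧
        ∀ l j, ∑ k, C l k z * m z j ^ (k : ℕ) = if l = j then 1 else 0 := by
  let L : (Fin q → ℝ) ≃L[ℝ] Fin q → ℝ :=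
    (LinearEquiv.ofInjectiveEndo (powerSumsDeriv μ : (Fin q → ℝ) →ₗ[ℝ] Fin q → ℝ)
      (powerSumsDeriv_injective hμ)).toContinuousLinearEquiv
  have hL : (L : (Fin q → ℝ) →L[ℝ] Fin q → ℝ) = powerSumsDeriv μ := by
    ext1 h
    rfl
  obtain ⟨e, he, hx, -, hsymm, hder⟩ := exists_smooth_local_inverse contDiff_powerSums L
    (hL ▸ hasFDerivAt_powerSums μ) isOpen_univ (Set.mem_univ _)
  -- The derivative of the power sums sends the `j`-th basis vector to `∑ k, (k+1) m j ^ k • e_k`.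
  -- The inverse derivative brings it back, and its `l`-th component says that the scaled partial
  -- derivatives are the coefficients of the `l`-th Lagrange polynomial.
  refine ⟨e.target, e.symm, fun l k z => ((k : ℕ) + 1) * fderiv ℝ e.symm z (Pi.single k 1) l,
    e.open_target, he ▸ e.map_source hx, he ▸ e.left_inv hx, fun l k => ?_, fun z hz => ⟨?_, ?_⟩⟩
  · have h := (hsymm.fderiv_of_isOpen (m := ∞) e.open_target (by simp)).clm_apply
      (contDiffOn_const (c := Pi.single k (1 : ℝ)))
    exact contDiffOn_const.mul (contDiffOn_pi.1 h l)
  · rw [← he]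
    exact e.right_inv hz
  · intro l j
    obtain ⟨L', hL'⟩ := hder _ (e.map_target hz)
    have h1 : (L' : (Fin q → ℝ) →L[ℝ] Fin q → ℝ) = powerSumsDeriv (e.symm z) :=
      hL'.unique (hasFDerivAt_powerSums _)
    have h2 := (e.hasFDerivAt_symm hz (he ▸ hL')).fderiv
    have h3 : L' (Pi.single j 1) =
        ∑ k : Fin q, (((k : ℕ) + 1 : ℝ) * e.symm z j ^ (k : ℕ)) • Pi.single k (1 : ℝ) := by
      rw [← ContinuousLinearEquiv.coe_coe, h1]
      ext k
      rw [powerSumsDeriv_apply, Finset.sum_apply]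
      simp [Pi.single_apply]
    have h4 := congrFun (L'.symm_apply_apply (Pi.single j 1)) l
    rw [h3, map_sum, Finset.sum_apply, Pi.single_apply] at h4
    rw [← h4]
    refine Finset.sum_congr rfl fun k _ => ?_
    simp only [h2]
    rw [map_smul, Pi.smul_apply, smul_eq_mul, ContinuousLinearEquiv.coe_coe]
    ring

/-- For odd `n` the index fixed by reversal lies in the half and would be counted twice, so `G` has
to vanish there. -/
theorem sum_eq_two_mul_sum_halfIndex {n : ℕ} [NeZero n] {G : Fin n → ℝ}
    (hG : ∀ i, G (Fin.rev i) = G i) (hmid : ∀ i, Fin.rev i = i → G i = 0) :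
    ∑ i, G i = 2 * ∑ l, G (halfIndex n l) := by
  have hn := NeZero.pos n
  let H : Fin n → ℝ := fun i => if (i : ℕ) ≤ (n - 1) / 2 then G i else 0
  have h1 : ∀ i, G i = H i + H (Fin.rev i) := by
    intro i
    have hi := i.2
    have hrev : (Fin.rev i : ℕ) = n - (i + 1) := Fin.val_rev i
    by_cases h : Fin.rev i = i
    · simp [H, h, hmid i h]
    · have h' : (Fin.rev i : ℕ) ≠ i := fun h' => h (Fin.ext h')
      simp only [H, hG]
      by_cases h2 : (i : ℕ) ≤ (n - 1) / 2
      · rw [if_pos h2, if_neg (by omega), add_zero]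
      · rw [if_neg h2, if_pos (by omega), zero_add]
  have h2 : ∑ i, H (Fin.rev i) = ∑ i, H i := Equiv.sum_comp Fin.revPerm H
  have h3 : ∑ l, G (halfIndex n l) = ∑ i, H i := by
    refine Fintype.sum_of_injective (halfIndex n) (fun l l' h => ?_) _ _ (fun i hi => ?_)
      fun l => ?_
    · simpa [halfIndex, Fin.ext_iff] using h
    · refine if_neg fun h => hi ⟨⟨i, by omega⟩, rfl⟩
    · have := l.2
      exact (if_pos (by simp only [halfIndex]; omega)).symm
  rw [Finset.sum_congr rfl fun i _ => h1 i, Finset.sum_add_distrib, h2, h3, two_mul]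

/-- The middle eigenvalue, if there is one, is zero; the exponents being positive, it does not
contribute to the sum. -/
theorem powerSums_halfIndex {n : ℕ} [NeZero n] {b : Fin n → ℝ} (hb : ∀ i, b i.rev = -b i)
    (k : Fin ((n - 1) / 2 + 1)) :
    powerSums (fun l => b (halfIndex n l) ^ 2) k = (∑ i, b i ^ (2 * ((k : ℕ) + 1))) / 2 := by
  rw [sum_eq_two_mul_sum_halfIndex (G := fun i => b i ^ (2 * ((k : ℕ) + 1)))]
  · simp only [powerSums, ← pow_mul]
    ring
  · intro i
    simp only [hb, (even_two_mul _).neg_pow]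
  · intro i hi
    have := hb i
    rw [hi] at this
    have h0 : b i = 0 := by linarith
    simp [h0]

theorem exists_eq_of_powerSums_eq {q : ℕ} {m m' : Fin q → ℝ} (h : powerSums m = powerSums m')
    (l : Fin q) : ∃ j, m l = m' j := by
  have h1 : Finset.univ.val.map m = Finset.univ.val.map m' := by
    refine multiset_eq_of_sum_pow_eq fun k hk hkq => ?_
    obtain ⟨k, rfl⟩ := Nat.exists_eq_add_of_le' hk
    exact congrFun h ⟨k, by omega⟩
  have h2 : m l ∈ Finset.univ.val.map m' := h1 ▸ Multiset.mem_map_of_mem m (Finset.mem_univ l)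
  obtain ⟨j, -, hj⟩ := Multiset.mem_map.1 h2
  exact ⟨j, hj.symm⟩

end HermitianSphere

/-! ### Flatness of the normal bundle. -/

namespace HermitianSphere

open EuclideanSubmanifold Filter Topology Matrix

variable {n : ℕ} {F : Type*} [NormedRing F] [InnerProductSpace ℝ F]

attribute [local instance] matrixTopology matrixT2Space

variable [StarRing F] [StarModule ℝ F] [HermitianAlgebra F]

/-- The relation for `Q'` makes it block off-diagonal with respect to `Q` (in particular `Q Q' Q =
0`), while a matrix commuting with `Q` is block diagonal. -/
theorem reTrace_mul_eq_zero_of_idempotent {Q Q' D : Matrix (Fin n) (Fin n) F} (hQ : Q * Q = Q)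
    (hQ' : Q' = Q' * Q + Q * Q') (hD : Q * D = D * Q) : reTrace n F (Q' * D) = 0 := by
  have h1 : Q * Q' * Q = 0 := by
    have h := congrArg (fun Z => Q * Z * Q) hQ'
    simp only [Matrix.mul_add, Matrix.add_mul] at h
    have e1 : Q * (Q' * Q) * Q = Q * Q' * Q := by
      rw [← Matrix.mul_assoc, Matrix.mul_assoc, hQ]
    have e2 : Q * (Q * Q') * Q = Q * Q' * Q := by rw [← Matrix.mul_assoc, hQ]
    rw [e1, e2] at h
    exact left_eq_add.1 h
  have h2 : reTrace n F (Q' * Q * D) = 0 := by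
    have e : Q' * Q * D = Q' * Q * D * Q := by
      rw [Matrix.mul_assoc (Q' * Q), ← hD, ← Matrix.mul_assoc, Matrix.mul_assoc Q' Q Q, hQ]
    rw [e, reTrace_mul_comm, ← Matrix.mul_assoc, ← Matrix.mul_assoc, h1, Matrix.zero_mul, map_zero]
  rw [hQ', Matrix.add_mul, map_add, h2, zero_add, Matrix.mul_assoc, reTrace_mul_comm,
    Matrix.mul_assoc, ← hD, ← Matrix.mul_assoc, h2]

variable [FiniteDimensional ℝ F]

section

attribute [local instance] matrixNormedRing matrixNormedAlgebra

theorem deriv_eq_of_idempotent {Q : ℝ → Matrix (Fin n) (Fin n) F} {Q' : Matrix (Fin n) (Fin n) F}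
    (h : HasDerivAt Q Q' 0) (hQ : ∀ᶠ t in 𝓝 0, Q t * Q t = Q t) :
    Q' = Q' * Q 0 + Q 0 * Q' := by
  have h1 : HasDerivAt (fun t => Q t * Q t) (Q' * Q 0 + Q 0 * Q') 0 := h.mul h
  exact (h1.congr_of_eventuallyEq (hQ.mono fun t ht => ht.symm)).unique h |>.symm

/-- Linear combinations of commuting families of idempotents have derivatives that are orthogonal
to the commutant. -/
theorem exists_hasDerivAt_sum_idempotent {ι : Type*} [Fintype ι]
    {Q : ι → ℝ → Matrix (Fin n) (Fin n) F} (c : ι → ℝ) (hd : ∀ l, DifferentiableAt ℝ (Q l) 0)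
    (hQ : ∀ l, ∀ᶠ t in 𝓝 0, Q l t * Q l t = Q l t) :
    ∃ Q', HasDerivAt (fun t => ∑ l, c l • Q l t) Q' 0 ∧
      ∀ Z, (∀ l, Q l 0 * Z = Z * Q l 0) → reTrace n F (Q' * Z) = 0 := by
  refine ⟨∑ l, c l • deriv (Q l) 0,
    HasDerivAt.fun_sum fun l _ => (hd l).hasDerivAt.const_smul (c l), fun Z hZ => ?_⟩
  rw [Finset.sum_mul, map_sum]
  refine Finset.sum_eq_zero fun l _ => ?_
  rw [Matrix.smul_mul, map_smul, reTrace_mul_eq_zero_of_idempotent (hQ l).self_of_nhds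
    (deriv_eq_of_idempotent (hd l).hasDerivAt (hQ l)) (hZ l), smul_zero]

theorem contDiffOn_sum_smul_pow {q : ℕ} {U : Set (E n F)} {C : Fin q → E n F → ℝ}
    (hC : ∀ k, ContDiffOn ℝ ∞ (C k) U) :
    ContDiffOn ℝ ∞ (fun y : E n F => ∑ k : Fin q, C k y •
      (y : Matrix (Fin n) (Fin n) F) ^ (2 * (k : ℕ))) U :=
  ContDiffOn.sum fun k _ => (hC k).smul (contDiff_coe_pow _).contDiffOn

end

/-- An even polynomial with coefficients `C`, evaluated at `y`. -/
def evenPolynomial {q : ℕ} (C : Fin q → ℝ) (y : E n F) : Matrix (Fin n) (Fin n) F :=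
  ∑ k : Fin q, C k • (y : Matrix (Fin n) (Fin n) F) ^ (2 * (k : ℕ))

theorem evenPolynomial_of_eq_conjDiag {q : ℕ} (C : Fin q → ℝ) {y : E n F}
    {V : Matrix (Fin n) (Fin n) F} (hV : V ∈ unitaries n F) {b : Fin n → ℝ}
    (hy : (y : Matrix (Fin n) (Fin n) F) = conjDiag V b) :
    evenPolynomial C y = conjDiag V fun i => ∑ k, C k * (b i ^ 2) ^ (k : ℕ) := by
  have h : (fun i => ∑ k, C k * (b i ^ 2) ^ (k : ℕ)) = ∑ k : Fin q, C k • b ^ (2 * (k : ℕ)) := by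
    ext i
    simp [pow_mul]
  rw [h, map_sum, evenPolynomial]
  refine Finset.sum_congr rfl fun k _ => ?_
  rw [map_smul, conjDiag_pow hV, hy]

theorem sum_smul_evenPolynomial {ι : Type*} [Fintype ι] {q : ℕ} (c : ι → ℝ) (C : ι → Fin q → ℝ)
    (y : E n F) : ∑ l, c l • evenPolynomial (C l) y =
      evenPolynomial (fun k => ∑ l, c l * C l k) y := by
  simp only [evenPolynomial, Finset.smul_sum, smul_smul, Finset.sum_smul]
  exact Finset.sum_comm

theorem evenPolynomial_mul_comm {q r : ℕ} (C : Fin q → ℝ) (C' : Fin r → ℝ) (y : E n F) :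
    evenPolynomial C y * evenPolynomial C' y = evenPolynomial C' y * evenPolynomial C y := by
  obtain ⟨V, hV, b, -, hy⟩ := exists_eq_conjDiag y
  have hV := unitaryComponent_subset hV
  rw [evenPolynomial_of_eq_conjDiag C hV hy, evenPolynomial_of_eq_conjDiag C' hV hy,
    ← conjDiag_mul hV, ← conjDiag_mul hV, mul_comm]

theorem evenPolynomial_conjTranspose {q : ℕ} (C : Fin q → ℝ) (y : E n F) :
    (evenPolynomial C y)ᴴ = evenPolynomial C y := by
  simp only [evenPolynomial, conjTranspose_sum, conjTranspose_smul, pow_conjTranspose, star_trivial]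

theorem projE_evenPolynomial [NeZero n] {p : ℕ} (C : Fin (p + 1) → ℝ) (y : E n F) :
    projE n F (evenPolynomial C y) = ∑ j : Fin p, C j.succ •
      projE n F ((y : Matrix (Fin n) (Fin n) F) ^ (2 * (j : ℕ) + 2)) := by
  rw [evenPolynomial, Fin.sum_univ_succ, map_add, map_smul, map_sum]
  simp only [Fin.val_zero, mul_zero, pow_zero, projE_one, smul_zero, zero_add, Fin.val_succ]
  exact Finset.sum_congr rfl fun j _ => map_smul (projE n F) _ _

/-- The constant coefficient is immaterial since `projE` kills `1`; admitting it lets Lagrange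
interpolation use all `(n - 1) / 2 + 1` coefficients. -/
theorem mem_normalSpace_B_iff [NeZero n] {y : E n F} (hy : y ∈ B n F) {v : E n F} :
    v ∈ normalSpace (S n F) (B n F) y ↔
      ∃ C : Fin ((n - 1) / 2 + 1) → ℝ, v = projE n F (evenPolynomial C y) := by
  refine ((homogeneousSystem_Phi (n := n) (F := F)).mem_normalSpace_iff hy).trans ⟨?_, ?_⟩
  · rintro ⟨g, rfl⟩
    exact ⟨Fin.cons 0 g, by rw [projE_evenPolynomial]; rfl⟩
  · rintro ⟨C, rfl⟩
    exact ⟨fun j => C j.succ, projE_evenPolynomial C y⟩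

/-- On `B`, the power sums of the different squares of eigenvalues. -/
def halfTraces (y : E n F) : Fin ((n - 1) / 2 + 1) → ℝ := fun k => f (2 * ((k : ℕ) + 1)) y / 2

theorem contDiff_halfTraces :
    ContDiff ℝ ∞ (halfTraces : E n F → Fin ((n - 1) / 2 + 1) → ℝ) :=
  contDiff_pi.2 fun _ => (contDiff_f _).div_const 2

/-- The traces of even powers are smooth on all of `E n F`, so smooth functions of the power sums
become smooth functions of `y`, with no need to differentiate eigenvalues. -/
theorem halfTraces_eq_powerSums [NeZero n] {y : E n F} {V : Matrix (Fin n) (Fin n) F}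
    (hV : V ∈ unitaries n F) {b : Fin n → ℝ} (hb : b ∈ spectralCone n)
    (hy : (y : Matrix (Fin n) (Fin n) F) = conjDiag V b) :
    halfTraces y = powerSums fun l => b (halfIndex n l) ^ 2 := by
  ext k
  rw [powerSums_halfIndex hb.1, halfTraces, f_of_eq_conjDiag hV hy]

theorem exists_sq_eq_of_powerSums_eq [NeZero n] {y : E n F} {V : Matrix (Fin n) (Fin n) F}
    (hV : V ∈ unitaries n F) {b : Fin n → ℝ} (hb : b ∈ spectralCone n)
    (hy : (y : Matrix (Fin n) (Fin n) F) = conjDiag V b) {m : Fin ((n - 1) / 2 + 1) → ℝ}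
    (hm : powerSums m = halfTraces y) (i : Fin n) : ∃ j, b i ^ 2 = m j := by
  rw [halfTraces_eq_powerSums hV hb hy] at hm
  obtain ⟨l, hl⟩ := sq_eq_halfIndex hb.1 i
  obtain ⟨j, hj⟩ := exists_eq_of_powerSums_eq hm.symm l
  exact ⟨j, hl.trans hj⟩

/-- By Newton the squared eigenvalues of `y` are among the nodes `m`, in whatever order. A Lagrange
polynomial takes only the values `0` and `1` there, so in `y ^ 2` it gives a spectral projection. -/
theorem evenPolynomial_idempotent [NeZero n] {y : E n F} (hy : y ∈ B n F)
    {m C : Fin ((n - 1) / 2 + 1) → ℝ} (hm : powerSums m = halfTraces y)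
    {l : Fin ((n - 1) / 2 + 1)}
    (hC : ∀ j, ∑ k, C k * m j ^ (k : ℕ) = if l = j then 1 else 0) :
    evenPolynomial C y * evenPolynomial C y = evenPolynomial C y := by
  obtain ⟨V, hV, b, hb, -, hyb⟩ := exists_spectrum_of_mem_B hy
  have hV := unitaryComponent_subset hV
  rw [evenPolynomial_of_eq_conjDiag C hV hyb, ← conjDiag_mul hV]
  congr 1
  ext i
  obtain ⟨j, hj⟩ := exists_sq_eq_of_powerSums_eq hV hb hyb hm i
  simp [hj, hC]

/-- Lagrange interpolation of the polynomial `g` at the nodes `m`, evaluated on the spectrum of `y ^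
2`. -/
theorem sum_smul_evenPolynomial_eq [NeZero n] {y : E n F} (hy : y ∈ B n F)
    {m g : Fin ((n - 1) / 2 + 1) → ℝ} {C : Fin ((n - 1) / 2 + 1) → Fin ((n - 1) / 2 + 1) → ℝ}
    (hm : powerSums m = halfTraces y)
    (hC : ∀ l j, ∑ k, C l k * m j ^ (k : ℕ) = if l = j then 1 else 0) :
    ∑ l, (∑ k, g k * m l ^ (k : ℕ)) • evenPolynomial (C l) y = evenPolynomial g y := by
  obtain ⟨V, hV, b, hb, -, hyb⟩ := exists_spectrum_of_mem_B hy
  have hV := unitaryComponent_subset hV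
  rw [evenPolynomial_of_eq_conjDiag g hV hyb]
  simp only [fun l => evenPolynomial_of_eq_conjDiag (C l) hV hyb, ← map_smul]
  rw [← map_sum]
  congr 1
  ext i
  obtain ⟨j, hj⟩ := exists_sq_eq_of_powerSums_eq hV hb hyb hm i
  simp [hj, hC]

/-- Linear combinations of spectral projections are parallel normal fields. -/
theorem normalDerivative_eq_zero_of_idempotent [NeZero n] {ι : Type*} [Fintype ι] {q : ℕ}
    {U : Set (E n F)} (hU : IsOpen U) (c : ι → ℝ) {C : ι → Fin q → E n F → ℝ}
    (hC : ∀ l k, ContDiffOn ℝ ∞ (C l k) U)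
    (hQ : ∀ y ∈ B n F ∩ U, ∀ l, evenPolynomial (fun k => C l k y) y *
      evenPolynomial (fun k => C l k y) y = evenPolynomial (fun k => C l k y) y)
    {y : E n F} (hy : y ∈ B n F ∩ U) :
    normalDerivative (S n F) (B n F)
      (fun y => projE n F (∑ l, c l • evenPolynomial (fun k => C l k y) y)) y = 0 := by
  have hdiff : ∀ l, DifferentiableAt ℝ (fun y => evenPolynomial (fun k => C l k y) y) y := fun l =>
    ((contDiffOn_sum_smul_pow (hC l)).contDiffAt (hU.mem_nhds hy.2)).differentiableAt (by simp)
  have hcurve : ∀ X γ, IsCurveThrough (B n F) y X γ → ∀ D,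
      HasDerivAt ((fun y => projE n F (∑ l, c l • evenPolynomial (fun k => C l k y) y)) ∘ γ) D 0 →
      ∀ v ∈ normalSpace (S n F) (B n F) y, inner ℝ D v = 0 := by
    intro X γ hγ D hD v hv
    have hmem : ∀ᶠ t in 𝓝 (0 : ℝ), γ t ∈ B n F ∩ U := by
      filter_upwards [hγ.mem, (hγ.hasDerivAt.continuousAt).eventually_mem
        (hU.mem_nhds (hγ.zero.symm ▸ hy.2))] with t h1 h2
      exact ⟨h1, h2⟩
    obtain ⟨Q', hQ', htr⟩ := exists_hasDerivAt_sum_idempotent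
      (Q := fun l t => evenPolynomial (fun k => C l k (γ t)) (γ t)) c (fun l => by
        have h := hdiff l
        rw [← hγ.zero] at h
        exact h.comp (0 : ℝ) hγ.hasDerivAt.differentiableAt)
      (fun l => hmem.mono fun t ht => hQ _ ht l)
    have hD' : D = projE n F Q' := hD.unique ((projE n F).hasFDerivAt.comp_hasDerivAt 0 hQ')
    obtain ⟨g, rfl⟩ := (mem_normalSpace_B_iff hy.1).1 hv
    rw [hD', inner_projE, inner_eq_reTrace, coe_conjTranspose]
    -- A normal vector is an even polynomial in `y` minus a scalar, hence commutes with every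
    -- spectral projection at `y`.
    refine htr _ fun l => ?_
    rw [coe_projE (evenPolynomial_conjTranspose g y), hγ.zero, Matrix.mul_sub, Matrix.sub_mul,
      evenPolynomial_mul_comm, Matrix.mul_smul, Matrix.smul_mul, Matrix.one_mul, Matrix.mul_one]
  refine normalDerivative_eq_zero (DifferentiableAt.differentiableWithinAt ?_) hcurve
  exact (projE n F).differentiableAt.comp y
    (DifferentiableAt.fun_sum fun l _ => (hdiff l).const_smul (c l))

theorem hasFlatNormalBundle_B [NeZero n] : HasFlatNormalBundle (S n F) (B n F) := by
  intro x hx v hv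
  obtain ⟨U, hU, a, ha, h1, hxa⟩ := exists_spectrum_of_mem_B hx
  have hU := unitaryComponent_subset hU
  have hne : a ≠ 0 := fun h => by simp [h] at h1
  obtain ⟨T, m, C, hT, hμT, hmμ, hC, hlag⟩ :=
    exists_smooth_lagrange ((mem_spectralCone_iff ha.2.1 ha.1 hne).1 ha)
  have hx' := halfTraces_eq_powerSums hU ha hxa
  rw [← hx'] at hμT hmμ
  obtain ⟨g, rfl⟩ := (mem_normalSpace_B_iff hx).1 hv
  have hs := contDiff_halfTraces (n := n) (F := F)
  have hTo : IsOpen (halfTraces ⁻¹' T : Set (E n F)) := hT.preimage hs.continuous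
  have hCs : ∀ l k, ContDiffOn ℝ ∞ (fun y : E n F => C l k (halfTraces y)) (halfTraces ⁻¹' T) :=
    fun l k => (hC l k).comp hs.contDiffOn fun _ hy => hy
  -- The normal vector is the projection of `g (x ^ 2)`. The values of `g` at the squared
  -- eigenvalues of `x` are frozen as constants while the spectral projections vary with `y`: the
  -- field is parallel and equals the given vector at `x`.
  let c : Fin ((n - 1) / 2 + 1) → ℝ := fun l => ∑ k, g k * m (halfTraces x) l ^ (k : ℕ)
  refine ⟨halfTraces ⁻¹' T, fun y => projE n F (∑ l, c l •
    evenPolynomial (fun k => C l k (halfTraces y)) y), hTo, hμT, ⟨?_, fun y hy => ?_⟩, ?_,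
    fun y hy => normalDerivative_eq_zero_of_idempotent hTo c hCs (fun z hz l =>
      evenPolynomial_idempotent hz.1 (hlag _ hz.2).1 ((hlag _ hz.2).2 l)) hy⟩
  · refine ((projE n F).contDiff.comp_contDiffOn (ContDiffOn.sum fun l _ => ?_)).mono
      Set.inter_subset_right
    have h : ContDiffOn ℝ ∞ (fun y : E n F => evenPolynomial (fun k => C l k (halfTraces y)) y)
      (halfTraces ⁻¹' T) := contDiffOn_sum_smul_pow (hCs l)
    exact h.const_smul (c l)
  · rw [mem_normalSpace_B_iff hy.1, sum_smul_evenPolynomial]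
    exact ⟨_, rfl⟩
  · change projE n F (∑ l, c l • evenPolynomial (fun k => C l k (halfTraces x)) x) = _
    rw [sum_smul_evenPolynomial_eq hx (hlag _ hμT).1 (hlag _ hμT).2]

end HermitianSphere

/-! ### Assembly for the three algebras. -/

namespace HermitianSphere

open EuclideanSubmanifold

theorem properties_B (F : Type*) [NormedRing F] [InnerProductSpace ℝ F] [StarRing F]
    [StarModule ℝ F] [HermitianAlgebra F] [FiniteDimensional ℝ F] {n : ℕ} (hn : 2 ≤ n) :
    B n F ⊆ S n F ∧
      IsSubmanifold (B n F) (N n F - (n - 1) / 2 - 1) ∧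
      IsOrientable (B n F) (N n F - (n - 1) / 2 - 1) ∧
      IsConnected (B n F) ∧
      IsFull (B n F) ∧
      IsAustere (S n F) (B n F) ∧
      HasFlatNormalBundle (S n F) (B n F) :=
  have : NeZero n := ⟨by omega⟩
  have h := homogeneousSystem_Phi (n := n) (F := F)
  ⟨fun _ hA => hA.1, h.isSubmanifold (codim_add hn), h.isOrientable (codim_add hn),
    isConnected_B hn, isFull_B hn, isAustere_B, hasFlatNormalBundle_B⟩

end HermitianSphere
end

open EuclideanSubmanifold HermitianSphere in
theorem mainTheorem1 (n : ℕ) (hn : 2 ≤ n) :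
    (B n ℝ ⊆ S n ℝ ∧
      IsSubmanifold (B n ℝ) (N n ℝ - (n - 1) / 2 - 1) ∧
      IsOrientable (B n ℝ) (N n ℝ - (n - 1) / 2 - 1) ∧
      IsConnected (B n ℝ) ∧
      IsFull (B n ℝ) ∧
      IsAustere (S n ℝ) (B n ℝ) ∧
      HasFlatNormalBundle (S n ℝ) (B n ℝ)) ∧
    (B n ℂ ⊆ S n ℂ ∧
      IsSubmanifold (B n ℂ) (N n ℂ - (n - 1) / 2 - 1) ∧
      IsOrientable (B n ℂ) (N n ℂ - (n - 1) / 2 - 1) ∧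
      IsConnected (B n ℂ) ∧
      IsFull (B n ℂ) ∧
      IsAustere (S n ℂ) (B n ℂ) ∧
      HasFlatNormalBundle (S n ℂ) (B n ℂ)) ∧
    (B n ℍ[ℝ] ⊆ S n ℍ[ℝ] ∧
      IsSubmanifold (B n ℍ[ℝ]) (N n ℍ[ℝ] - (n - 1) / 2 - 1) ∧
      IsOrientable (B n ℍ[ℝ]) (N n ℍ[ℝ] - (n - 1) / 2 - 1) ∧
      IsConnected (B n ℍ[ℝ]) ∧
      IsFull (B n ℍ[ℝ]) ∧
      IsAustere (S n ℍ[ℝ]) (B n ℍ[ℝ]) ∧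
      HasFlatNormalBundle (S n ℍ[ℝ]) (B n ℍ[ℝ])) :=
  ⟨properties_B ℝ hn, properties_B ℂ hn, properties_B ℍ[ℝ] hn⟩
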